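/- Let $K,d\ge 1$ and $R_1,\dots,R_K\ge 0$ be integers. A parameter is $\theta=(\pi,\mu,V)$ with $\pi\in\mathbb R^K$, $\mu_j\in\mathbb R^d$, $V_j\in\mathbb R^{d\times R_j}$; put $\Sigma_j=V_jV_j^T$. It is a mixture parameter if $\pi_j>0$ for all $j$ and $\sum_j\pi_j=1$; the Gaussian mixture is then $Y\sim\sum_{j=1}^K\pi_j\,\mathcal N(\mu_j,\Sigma_j)$. For $k\ge0$ let $\mathcal M^{(k)}(\theta)$ and $\mathcal M^{(k)}(\theta_j)$ be the order-$k$ moment tensors (entries $\mathbb E[Y_{i_1}\cdots Y_{i_k}]$) of the mixture and of its $j$-th component $\mathcal N(\mu_j,\Sigma_j)$, with the entrywise inner product and norm, and $\alpha_k(\theta)=\|\mathcal M^{(k)}(\theta)\|^2$. Let $\kappa^{(l)}_{ij}$ be the $l$-th cumulant (the $l$-th derivative at $0$ of the cumulant generating function) of $\langle X_i,X_j\rangle$ for independent $X_i\sim\mathcal N(\mu_i,\Sigma_i)$, $X_j\sim\mathcal N(\mu_j,\Sigma_j)$ (two independent copies if $i=j$), and let $$B_k(x_1,\dots,x_k)=\sum_{\substack{j_1,\dots,j_k\ge0\\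 j_1+2j_2+\dots+kj_k=k}}\frac{k!}{j_1!\cdots j_k!}\prod_{l=1}^k\Big(\frac{x_l}{l!}\Big)^{j_l}$$ be the complete Bell polynomials. **(1)** For every mixture parameter $\theta$ and every $k\ge0$, all moments involved are finite, the moment generating function of each $\langle X_i,X_j\rangle$ is finite near $0$, and $$\alpha_k(\theta)=\sum_{i,j=1}^K\pi_i\pi_j\langle\mathcal M^{(k)}(\theta_i),\mathcal M^{(k)}(\theta_j)\rangle=\sum_{i,j=1}^K\pi_i\pi_j\,B_k\big(\kappa^{(1)}_{ij},\dots,\kappa^{(k)}_{ij}\big),$$ where, for all $m\ge0$, $$\kappa^{(2m+1)}_{ij}=(2m+1)!\;\mu_j^T(\Sigma_i\Sigma_j)^m\mu_i,$$ $$\kappa^{(2m+2)}_{ij}=(2m+1)!\,\operatorname{Tr}\big((\Sigma_i\Sigma_j)^{m+1}\big)+\tfrac{(2m+2)!}{2}\,\mu_i^T\Sigma_j(\Sigma_i\Sigma_j)^m\mu_i+\tfrac{(2m+2)!}{2}\,\mu_j^T(\Sigma_i\Sigma_j)^m\Sigma_i\mu_j .$$ Moreover $\alpha_k$, extended to all $\pi$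 with positive entries as the squared norm of the moment tensor of the unnormalised mixture $\sum_j\pi_j\mathcal N(\mu_j,\Sigma_j)$, is differentiable at $\theta$ as a function of all entries of $(\pi,\mu,V)$. **(2)** There is an absolute constant $C$ such that the following holds for all $k\ge1$, $K$, $d$ and $R_1,\dots,R_K$ with $1\le R_{\max}:=\max_jR_j\le d$. Operations are additions, subtractions and multiplications of real numbers in a straight-line program whose inputs are the entries of $\theta$ and whose only constant is $1$; the program depends only on $k,K,d,R_1,\dots,R_K$ (and on $j$, for the gradients) and is correct at every mixture parameter $\theta$. * $\alpha_k(\theta)$ can be computed in at most $C\,(k^2K^2+kK^2dR_{\max}^2)$ operations. * For each $j$, the partial derivative $\nabla_{\pi_j}\alpha_k(\theta)$ can be computed in at most $C\,(k^2K+kKdR_{\max}^2)$ operations. * For each $j$, the full gradient $\nabla_{\mu_j}\alpha_k(\theta)\in\mathbb R^d$, and likewise the full gradient $\nabla_{V_j}\alpha_k(\theta)\in\mathbb R^{d\times R_j}$, can be computed in at most $C\,(k^2K^2+kK^2dR_{\max}^2)$ operations. -/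

import Mathlib

/-- The coordinates of the parameter vector `θ = [π; μ; vec V]` of a `K`-component mixture in
dimension `d` whose `j`-th covariance factor has `R j` columns: one coordinate for each weight
`π_j`, for each entry of a mean `μ_j`, and for each entry of a factor `V_j`. -/
abbrev ParamIdx (K d : ℕ) (R : Fin K → ℕ) : Type :=
  Fin K ⊕ (Fin K × Fin d) ⊕ (Σ j : Fin K, Fin d × Fin (R j))

/-- The coordinate of `π_j`. -/
def weightIdx {K d : ℕ} {R : Fin K → ℕ} (j : Fin K) : ParamIdx K d R :=
  Sum.inl j

/-- The coordinate of the `a`-th entry of `μ_j`. -/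
def meanIdx {K d : ℕ} {R : Fin K → ℕ} (j : Fin K) (a : Fin d) : ParamIdx K d R :=
  Sum.inr (Sum.inl (j, a))

/-- The coordinate of the `(a, r)` entry of `V_j`. -/
def factorIdx {K d : ℕ} {R : Fin K → ℕ} (j : Fin K) (a : Fin d) (r : Fin (R j)) :
    ParamIdx K d R :=
  Sum.inr (Sum.inr ⟨j, (a, r)⟩)

namespace GaussianMixture

variable {K d : ℕ} {R : Fin K → ℕ}

/-- The weight `π_j`. -/
def weight (θ : ParamIdx K d R → ℝ) (j : Fin K) : ℝ := θ (weightIdx j)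

/-- The mean `μ_j`. -/
def mean (θ : ParamIdx K d R → ℝ) (j : Fin K) : Fin d → ℝ := fun a => θ (meanIdx j a)

/-- The covariance factor `V_j`. -/
def factor (θ : ParamIdx K d R → ℝ) (j : Fin K) : Matrix (Fin d) (Fin (R j)) ℝ :=
  Matrix.of fun a r => θ (factorIdx j a r)

/-- The covariance `Σ_j = V_j V_jᵀ`. -/
def cov (θ : ParamIdx K d R → ℝ) (j : Fin K) : Matrix (Fin d) (Fin d) ℝ :=
  factor θ j * (factor θ j).transpose

/-- `θ` is a mixture parameter: positive weights of total mass one. -/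
def IsMixtureParam (θ : ParamIdx K d R → ℝ) : Prop :=
  (∀ j, 0 < weight θ j) ∧ ∑ j, weight θ j = 1

/-- The law `N(μ_j, Σ_j)` of the `j`-th component `X_j`. -/
noncomputable def componentLaw (θ : ParamIdx K d R → ℝ) (j : Fin K) :
    MeasureTheory.Measure (EuclideanSpace ℝ (Fin d)) :=
  ProbabilityTheory.multivariateGaussian (WithLp.toLp 2 (mean θ j)) (cov θ j)

/-- The law of the mixture, `∑_j π_j N(μ_j, Σ_j)`. For positive weights of total mass different
from one it is the unnormalised mixture; this extends the norm of the moment tensor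
to a neighbourhood of the mixture parameters in the whole parameter space, where the gradients
are taken. -/
noncomputable def mixtureLaw (θ : ParamIdx K d R → ℝ) :
    MeasureTheory.Measure (EuclideanSpace ℝ (Fin d)) :=
  ∑ j, ENNReal.ofReal (weight θ j) • componentLaw θ j

/-- The `k`-th moment tensor of a measure on `ℝ^d`, with entries `E[Y_{i_1} ⋯ Y_{i_k}]`. The
Euclidean structure on the space of arrays indexed by `(i_1, …, i_k)` is the entrywise inner product
of tensors. -/
noncomputable def momentTensor {d : ℕ} (k : ℕ)
    (ν : MeasureTheory.Measure (EuclideanSpace ℝ (Fin d))) :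
    EuclideanSpace ℝ (Fin k → Fin d) :=
  WithLp.toLp 2 fun i => ∫ y, ∏ l, y (i l) ∂ν

/-- `α_k(θ) = ‖M^{(k)}(θ)‖²`. -/
noncomputable def alpha (k : ℕ) (θ : ParamIdx K d R → ℝ) : ℝ :=
  ‖momentTensor k (mixtureLaw θ)‖ ^ 2

/-- The partial derivative of `α_k` at `θ` in the coordinate `p` of the parameter vector. -/
noncomputable def partialAlpha (k : ℕ) (θ : ParamIdx K d R → ℝ) (p : ParamIdx K d R) : ℝ :=
  fderiv ℝ (fun θ' : ParamIdx K d R → ℝ => alpha k θ') θ (Pi.single p 1)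

/-- The `l`-th cumulant of a real random variable: the `l`-th derivative at zero of its
cumulant generating function. -/
noncomputable def cumulant {Ω : Type*} [MeasurableSpace Ω] (l : ℕ) (X : Ω → ℝ)
    (P : MeasureTheory.Measure Ω) : ℝ :=
  iteratedDeriv l (ProbabilityTheory.cgf X P) 0

/-- The joint law of independent vectors `X_i ~ N(μ_i, Σ_i)` and `X_j ~ N(μ_j, Σ_j)`
(for `i = j`, two independent copies). -/
noncomputable def pairLaw (θ : ParamIdx K d R → ℝ) (i j : Fin K) :
    MeasureTheory.Measure (EuclideanSpace ℝ (Fin d) × EuclideanSpace ℝ (Fin d)) :=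
  (componentLaw θ i).prod (componentLaw θ j)

/-- The random variable `⟨X, Y⟩`. -/
noncomputable def pairing (d : ℕ) :
    EuclideanSpace ℝ (Fin d) × EuclideanSpace ℝ (Fin d) → ℝ :=
  fun p => inner ℝ p.1 p.2

/-- `κ_{ij}^{(l)}`, the `l`-th cumulant of `⟨X_i, X_j⟩` for independent `X_i` and `X_j`. -/
noncomputable def kappa (θ : ParamIdx K d R → ℝ) (i j : Fin K) (l : ℕ) : ℝ :=
  cumulant l (pairing d) (pairLaw θ i j)

end GaussianMixture

/-- The complete Bell polynomial `B_k(x_1, …, x_k)`. The entry `x l` with `l : Fin k` is the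
variable `x_{l+1}`, and the sum is over all `(j_1, …, j_k)` with `j_1 + 2 j_2 + ⋯ + k j_k = k`
(each `j_l` is then at most `k`). -/
noncomputable def completeBell (k : ℕ) (x : Fin k → ℝ) : ℝ :=
  ∑ j ∈ (Fintype.piFinset fun _ : Fin k => Finset.range (k + 1)).filter
      (fun j => ∑ l : Fin k, (l.val + 1) * j l = k),
    ((k.factorial : ℝ) / ∏ l : Fin k, ((j l).factorial : ℝ)) *
      ∏ l : Fin k, (x l / ((l.val + 1).factorial : ℝ)) ^ j l

/-! Arithmetic programs: straight-line programs over the reals. The only operations are addition,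
subtraction and multiplication of two operands, each of which costs one. An operand is an input,
the constant one (the only constant), or the result of an earlier instruction. -/

/-- An operand of an instruction. -/
inductive Operand (ι : Type) : Type
  | input (i : ι)
  | one
  | reg (n : ℕ)

/-- A single arithmetic operation. -/
inductive Instr (ι : Type) : Type
  | add (a b : Operand ι)
  | sub (a b : Operand ι)
  | mul (a b : Operand ι)

/-- A straight-line program with inputs indexed by `ι` and outputs indexed by `o`. -/
structure ArithProgram (ι o : Type) : Type where
  instrs : List (Instr ι)
  outputs : o → Operand ι

/-- The value of an operand, given the inputs and the results of the operations performed so far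
(a reference to an operation not yet performed reads zero). -/
def Operand.eval {ι : Type} (x : ι → ℝ) (regs : List ℝ) : Operand ι → ℝ
  | .input i => x i
  | .one => 1
  | .reg n => regs.getD n 0

/-- The result of an operation. -/
noncomputable def Instr.eval {ι : Type} (x : ι → ℝ) (regs : List ℝ) : Instr ι → ℝ
  | .add a b => a.eval x regs + b.eval x regs
  | .sub a b => a.eval x regs - b.eval x regs
  | .mul a b => a.eval x regs * b.eval x regs

namespace ArithProgram

/-- The results of all operations, in the order of execution. -/
noncomputable def run {ι o : Type} (P : ArithProgram ι o) (x : ι → ℝ) : List ℝ :=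
  P.instrs.foldl (fun regs I => regs ++ [I.eval x regs]) []

/-- The outputs of the program on the input `x`. -/
noncomputable def eval {ι o : Type} (P : ArithProgram ι o) (x : ι → ℝ) (q : o) : ℝ :=
  (P.outputs q).eval x (P.run x)

/-- The number of arithmetic operations that the program performs. -/
def cost {ι o : Type} (P : ArithProgram ι o) : ℕ := P.instrs.length

end ArithProgram

/-!
The inner product of the order-`k` moment tensors of two Gaussian components is the `k`-th moment
of `⟨X, Y⟩` for independent `X ~ N(μ, P)` and `Y ~ N(ν, Q)`, because both are sums over the index
tuples of products of integrals. These moments satisfy a recursion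
`m_{n+1} = ∑_{i ≤ n} n (n-1) ⋯ (n-i+1) u_i m_{n-i}` in which the `u_i` (`pairCoeff`) are explicit
polynomials in the parameters. It comes from Gaussian integration by parts
(`gaussianExpectation_X_mul`): applied alternately to `X` and to `Y`, it turns the expectation of
`⟨X, Y⟩ ^ k (Yᵀ (P Q)^r X)` into expectations of linear forms, traces, and a term of the same shape
with a smaller `k` and a larger `r` (`IsSteinPair.map_pow_mul_bilForm_eq`).

By Fernique's theorem the moment generating function `M` of `⟨X, Y⟩` is finite near zero. The
Leibniz rule for `M' = M (log M)'` shows that the moments satisfy the same recursion with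
`κ^{(i+1)} / i!` in place of `u_i` (`integral_pow_eq_momentSeq_cumulant`). Since the recursion
determines its coefficients, `κ^{(i+1)} = i! u_i`, which is the formula for the cumulants; and since
the complete Bell polynomials satisfy the recursion as well (`completeBell_eq_momentSeq`), they give
the moments.

The recursion involves no division and a Horner scheme evaluates it with `O(k²)` operations. All
`u_i`, `i < k`, take `O(k d R²)` operations, because the powers of `P Q = V Vᵀ W Wᵀ` are only
applied to vectors, one factor at a time, and the traces of these powers are traces of powers of
the small matrix `Vᵀ W Wᵀ V`. Hence `α_k` agrees, as long as the weights are positive, with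
a polynomial of the required complexity; in particular it is differentiable. The derivative in
a weight is a linear combination of `2 K` of the inner products, and the gradients in the means and
the factors come from the program for `α_k` by reverse-mode differentiation
(`Computes.exists_gradient`), which costs a constant factor.
-/

/-! ### Straight-line computations in a commutative ring -/

/-- `x` is the sum, the difference or the product of two elements of `S`. -/
inductive IsArithStep {A : Type*} [CommRing A] (S : Set A) : A → Prop
  | add {a b : A} (ha : a ∈ S) (hb : b ∈ S) : IsArithStep S (a + b)
  | sub {a b : A} (ha : a ∈ S) (hb : b ∈ S) : IsArithStep S (a - b)
  | mul {a b : A} (ha : a ∈ S) (hb : b ∈ S) : IsArithStep S (a * b)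

/-- `Computes n S T`: starting from the elements of `S`, at most `n` additions, subtractions and
multiplications produce all elements of `T`. -/
inductive Computes {A : Type*} [CommRing A] : ℕ → Set A → Set A → Prop
  | of_subset {n : ℕ} {S T : Set A} (h : T ⊆ S) : Computes n S T
  | step {n : ℕ} {S T : Set A} {x : A} (hx : IsArithStep S x) (h : Computes n (insert x S) T) :
      Computes (n + 1) S T

namespace Computes

variable {A : Type*} [CommRing A] {n m : ℕ} {S S' T T' U : Set A}

theorem mono_cost (h : Computes n S T) (hnm : n ≤ m) : Computes m S T := by
  induction h generalizing m with
  | of_subset h => exact of_subset h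
  | step hx _ ih =>
    obtain ⟨m, rfl⟩ : ∃ m', m = m' + 1 := ⟨m - 1, by omega⟩
    exact step hx (ih (by omega))

theorem mono_left (h : Computes n S T) (hS : S ⊆ S') : Computes n S' T := by
  induction h generalizing S' with
  | of_subset h => exact of_subset (h.trans hS)
  | step hx _ ih =>
    refine step ?_ (ih (Set.insert_subset_insert hS))
    cases hx with
    | add ha hb => exact .add (hS ha) (hS hb)
    | sub ha hb => exact .sub (hS ha) (hS hb)
    | mul ha hb => exact .mul (hS ha) (hS hb)

theorem mono_right (h : Computes n S T) (hT : T' ⊆ T) : Computes n S T' := by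
  induction h with
  | of_subset h => exact of_subset (hT.trans h)
  | step hx _ ih => exact step hx (ih hT)

theorem union_self (h : Computes n S T) : Computes n S (S ∪ T) := by
  induction h with
  | of_subset h => exact of_subset (Set.union_subset subset_rfl h)
  | step hx _ ih =>
    exact step hx (ih.mono_right (Set.union_subset_union_left _ (Set.subset_insert _ _)))

theorem trans (h : Computes n S T) (h' : Computes m (S ∪ T) U) : Computes (n + m) S U := by
  induction h with
  | @of_subset n S T h =>
    rw [Set.union_eq_self_of_subset_right h] at h'
    exact h'.mono_cost (Nat.le_add_left _ _)
  | @step n S T x hx _ ih =>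
    rw [Nat.add_right_comm]
    exact step hx (ih (h'.mono_left (Set.union_subset_union_left _ (Set.subset_insert _ _))))

/-- Composition of computations in which the results of the first one are kept. -/
theorem trans_union (h : Computes n S T) (h' : Computes m (S ∪ T) U) :
    Computes (n + m) S (S ∪ T ∪ U) :=
  h.trans h'.union_self

theorem union (h : Computes n S T) (h' : Computes m S U) : Computes (n + m) S (T ∪ U) :=
  (h.trans_union (h'.mono_left Set.subset_union_left)).mono_right
    (Set.union_subset_union_left _ Set.subset_union_right)

theorem of_mem {x : A} (hx : x ∈ S) : Computes 0 S {x} :=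
  of_subset (Set.singleton_subset_iff.2 hx)

theorem of_step {x : A} (hx : IsArithStep S x) : Computes 1 S {x} :=
  step hx (of_subset (Set.singleton_subset_iff.2 (Set.mem_insert _ _)))

theorem add {a b : A} (ha : a ∈ S) (hb : b ∈ S) : Computes 1 S {a + b} := of_step (.add ha hb)

theorem sub {a b : A} (ha : a ∈ S) (hb : b ∈ S) : Computes 1 S {a - b} := of_step (.sub ha hb)

theorem mul {a b : A} (ha : a ∈ S) (hb : b ∈ S) : Computes 1 S {a * b} := of_step (.mul ha hb)

theorem biUnion {κ : Type*} (s : Finset κ) {T : κ → Set A} (h : ∀ i ∈ s, Computes n S (T i)) :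
    Computes (s.card * n) S (⋃ i ∈ s, T i) := by
  classical
  induction s using Finset.induction_on with
  | empty => exact of_subset (by simp)
  | insert i s hi ih =>
    rw [Finset.card_insert_of_notMem hi, Finset.set_biUnion_insert, Nat.succ_mul, Nat.add_comm]
    exact (h i (Finset.mem_insert_self _ _)).union
      (ih fun j hj => h j (Finset.mem_insert_of_mem hj))

theorem iUnion {κ : Type*} [Fintype κ] {T : κ → Set A} (h : ∀ i, Computes n S (T i)) :
    Computes (Fintype.card κ * n) S (⋃ i, T i) := by
  simpa using biUnion Finset.univ (T := T) fun i _ => h i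

theorem range {κ : Type*} [Fintype κ] {f : κ → A} (h : ∀ i, Computes n S {f i}) :
    Computes (Fintype.card κ * n) S (Set.range f) := by
  simpa [Set.iUnion_singleton_eq_range] using iUnion h

theorem sum_mul {κ : Type*} (h0 : (0 : A) ∈ S) (s : Finset κ) {x y : κ → A}
    (hx : ∀ i ∈ s, x i ∈ S) (hy : ∀ i ∈ s, y i ∈ S) :
    Computes (2 * s.card) S {∑ i ∈ s, x i * y i} := by
  classical
  induction s using Finset.induction_on with
  | empty => exact of_mem (by simpa using h0)
  | insert i s hi ih =>
    rw [Finset.card_insert_of_notMem hi, Finset.sum_insert hi]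
    have h1 := ih (fun j hj => hx j (Finset.mem_insert_of_mem hj))
      (fun j hj => hy j (Finset.mem_insert_of_mem hj))
    have h2 := h1.trans_union (mul (Or.inl (hx i (Finset.mem_insert_self _ _)))
      (Or.inl (hy i (Finset.mem_insert_self _ _))))
    refine (h2.trans (add (a := x i * y i) (b := ∑ j ∈ s, x j * y j) ?_ ?_)).mono_cost (by omega)
    · simp
    · simp

theorem dotProduct {κ : Type*} [Fintype κ] (h0 : (0 : A) ∈ S) {x y : κ → A}
    (hx : Set.range x ⊆ S) (hy : Set.range y ⊆ S) :
    Computes (2 * Fintype.card κ) S {x ⬝ᵥ y} :=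
  sum_mul h0 Finset.univ (fun i _ => hx ⟨i, rfl⟩) (fun i _ => hy ⟨i, rfl⟩)

/-- A sequence of sets each of which is obtained from its predecessor by `n` operations. -/
theorem iterate {T : ℕ → Set A} {N : ℕ} (h : ∀ k < N, Computes n (S ∪ T k) (T (k + 1))) :
    Computes (N * n) (S ∪ T 0) (⋃ k ≤ N, T k) := by
  induction N with
  | zero => exact of_subset (by simp)
  | succ N ih =>
    have h1 := ih fun k hk => h k (by omega)
    have h2 : Computes n (S ∪ T 0 ∪ ⋃ k ≤ N, T k) (T (N + 1)) :=
      (h N (by omega)).mono_left (Set.union_subset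
        (Set.subset_union_left.trans Set.subset_union_left)
        fun y hy => Or.inr (Set.mem_iUnion₂.2 ⟨N, le_refl N, hy⟩))
    rw [Nat.succ_mul]
    refine (h1.trans_union h2).mono_right (Set.iUnion₂_subset fun k hk => ?_)
    rcases Nat.lt_or_ge N k with h3 | h3
    · rw [show k = N + 1 by omega]
      exact Set.subset_union_right
    · exact fun y hy => Or.inl (Or.inr (Set.mem_iUnion₂.2 ⟨k, h3, hy⟩))

/-! ### Reverse-mode differentiation -/

section Gradient

variable {k : Type*} [CommRing k] [Algebra k A]

theorem _root_.Finsupp.sum_add_single_mul (c : A →₀ A) (a δ : A) (D : Derivation k A A) :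
    ((c + Finsupp.single a δ).sum fun s u => u * D s) = (c.sum fun s u => u * D s) + δ * D a := by
  rw [Finsupp.sum_add_index' (by simp) (fun _ _ _ => add_mul _ _ _),
    Finsupp.sum_single_index (by simp)]

theorem _root_.Finsupp.sum_erase_add_mul (c : A →₀ A) (a : A) (D : Derivation k A A) :
    ((c.erase a).sum fun s u => u * D s) + c a * D a = c.sum fun s u => u * D s := by
  conv_rhs => rw [← Finsupp.erase_add_single a c]
  rw [Finsupp.sum_add_single_mul]

theorem _root_.Finsupp.range_add_single_subset (c : A →₀ A) (a δ : A) :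
    Set.range (c + Finsupp.single a δ) ⊆ Set.range c ∪ {c a + δ} := by
  rintro _ ⟨s, rfl⟩
  by_cases h : a = s
  · subst h; simp
  · simp [Finsupp.single_eq_of_ne (Ne.symm h)]

theorem _root_.Finsupp.range_erase_subset (c : A →₀ A) (a : A) :
    Set.range (c.erase a) ⊆ Set.range c ∪ {0} := by
  classical
  rintro _ ⟨s, rfl⟩
  rw [Finsupp.erase_apply]
  split_ifs <;> simp

variable (k) in
/-- **Reverse-mode differentiation** (Baur and Strassen). If `f` is computed from `S` by `n`
operations, then `5 n` operations compute coefficients `c_s`, `s ∈ S`, such that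
`D f = ∑ c_s D s` for every derivation `D`. The first operation of the computation produces some
`x`; the computation of `f` from `S ∪ {x}` is differentiated by induction, and the term `c_x D x`
is then distributed to the two operands of `x`. -/
theorem exists_gradient {f : A} (h : Computes n S {f}) (h0 : (0 : A) ∈ S) (h1 : (1 : A) ∈ S) :
    ∃ c : A →₀ A, (↑c.support ⊆ S) ∧
      (∀ D : Derivation k A A, D f = c.sum fun s u => u * D s) ∧
      Computes (5 * n) S (Set.range c) := by
  classical
  generalize hT : ({f} : Set A) = T at h
  induction h with
  | @of_subset n S T h =>
    subst hT
    refine ⟨Finsupp.single f 1, ?_, fun D => by simp, of_subset ?_⟩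
    · exact (Finset.coe_subset.2 Finsupp.support_single_subset).trans (by simpa using h)
    · rintro _ ⟨s, rfl⟩
      rw [Finsupp.single_apply]
      split_ifs <;> assumption
  | @step n S T x hx _ ih =>
    obtain ⟨c, hcS, hcD, hc⟩ := ih (Or.inr h0) (Or.inr h1) hT
    set e := c.erase x with he
    have heS : ↑e.support ⊆ S := by
      intro s hs
      rw [he, Finsupp.support_erase, Finset.coe_erase] at hs
      exact (hcS hs.1).resolve_left hs.2
    have hD : ∀ D : Derivation k A A,
        D f = (e.sum fun s u => u * D s) + c x * D x := fun D => by
      rw [hcD D, he, Finsupp.sum_erase_add_mul]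
    set W : Set A := insert x S ∪ (insert x S ∪ Set.range c) with hW
    have hcW : Computes (1 + 5 * n) S W := by
      refine (of_step hx).trans ?_
      rw [Set.union_comm S, Set.singleton_union]
      exact hc.union_self.union_self
    have heW : Set.range e ⊆ W := by
      refine (Finsupp.range_erase_subset c x).trans (Set.union_subset ?_ ?_)
      · exact Set.subset_union_right.trans Set.subset_union_right
      · simp [hW, h0]
    have hxW : c x ∈ W := by simp [hW]
    have hSW : S ⊆ W := fun s hs => by simp [hW, hs]
    -- Correcting the coefficients of two elements of `S` costs one operation for each.
    have key : ∀ (W' : Set A) (a b δ₁ δ₂ : A), W ⊆ W' →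
        (∀ S', W' ⊆ S' → ∀ y ∈ S', Computes 1 S' {y + δ₁}) →
        (∀ S', W' ⊆ S' → ∀ y ∈ S', Computes 1 S' {y + δ₂}) →
        Computes 2 W' (Set.range (e + Finsupp.single a δ₁ + Finsupp.single b δ₂)) := by
      intro W' a b δ₁ δ₂ hW' h1 h2
      have correct : ∀ (e : A →₀ A) (a δ : A) (S' : Set A), Set.range e ⊆ S' →
          Computes 1 S' {e a + δ} → Computes 1 S' (Set.range (e + Finsupp.single a δ)) :=
        fun e a δ S' h1 h2 => h2.union_self.mono_right
          ((Finsupp.range_add_single_subset e a δ).trans (Set.union_subset_union_left _ h1))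
      exact (correct e a δ₁ W' (heW.trans hW') (h1 W' subset_rfl _ (hW' (heW ⟨a, rfl⟩)))).trans
        (correct _ b δ₂ _ Set.subset_union_right
          (h2 _ Set.subset_union_left _ (Or.inr ⟨b, rfl⟩)))
    have hsupp : ∀ (e : A →₀ A) (a δ : A), ↑e.support ⊆ S → a ∈ S →
        ↑(e + Finsupp.single a δ).support ⊆ S := by
      intro e a δ h1 h2 s hs
      rcases Finset.mem_union.1 (Finsupp.support_add hs) with h | h
      · exact h1 h
      · rw [Finset.mem_singleton.1 (Finsupp.support_single_subset h)]
        exact h2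
    cases hx with
    | @add a b ha hb =>
      refine ⟨e + Finsupp.single a (c (a + b)) + Finsupp.single b (c (a + b)),
        hsupp _ _ _ (hsupp _ _ _ heS ha) hb, fun D => ?_, ?_⟩
      · rw [Finsupp.sum_add_single_mul, Finsupp.sum_add_single_mul, hD, D.map_add]
        ring
      · refine (hcW.trans ((key W a b _ _ subset_rfl ?_ ?_).mono_left
          Set.subset_union_right)).mono_cost (by omega) <;>
        exact fun S' hS' y hy => Computes.add hy (hS' hxW)
    | @sub a b ha hb =>
      refine ⟨e + Finsupp.single a (c (a - b)) + Finsupp.single b (-c (a - b)),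
        hsupp _ _ _ (hsupp _ _ _ heS ha) hb, fun D => ?_, ?_⟩
      · rw [Finsupp.sum_add_single_mul, Finsupp.sum_add_single_mul, hD, D.map_sub]
        ring
      · refine (hcW.trans ((key W a b _ _ subset_rfl ?_ ?_).mono_left
          Set.subset_union_right)).mono_cost (by omega)
        · exact fun S' hS' y hy => Computes.add hy (hS' hxW)
        · exact fun S' hS' y hy => by
            rw [← sub_eq_add_neg]
            exact Computes.sub hy (hS' hxW)
    | @mul a b ha hb =>
      refine ⟨e + Finsupp.single a (b * c (a * b)) + Finsupp.single b (a * c (a * b)),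
        hsupp _ _ _ (hsupp _ _ _ heS ha) hb, fun D => ?_, ?_⟩
      · rw [Finsupp.sum_add_single_mul, Finsupp.sum_add_single_mul, hD, D.leibniz]
        simp only [smul_eq_mul]
        ring
      · set W' : Set A := W ∪ ({b * c (a * b)} ∪ {a * c (a * b)}) with hW'
        have hW1 : Computes 2 W W' :=
          ((Computes.mul (hSW hb) hxW).union (Computes.mul (hSW ha) hxW)).union_self
        refine (hcW.trans ((hW1.trans ((key W' a b _ _ Set.subset_union_left ?_ ?_).mono_left
          Set.subset_union_right)).mono_left Set.subset_union_right)).mono_cost (by omega)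
        · exact fun S' hS' y hy => Computes.add hy (hS' (Or.inr (Or.inl rfl)))
        · exact fun S' hS' y hy => Computes.add hy (hS' (Or.inr (Or.inr rfl)))

end Gradient

end Computes

/-! ### Programs from straight-line computations -/

namespace ArithProgram

variable {ι o : Type}

/-- The results of a list of instructions, in the order of execution. -/
noncomputable def results (l : List (Instr ι)) (x : ι → ℝ) : List ℝ :=
  l.foldl (fun regs I => regs ++ [I.eval x regs]) []

theorem results_concat (l : List (Instr ι)) (I : Instr ι) (x : ι → ℝ) :
    results (l ++ [I]) x = results l x ++ [I.eval x (results l x)] := by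
  simp [results]

@[simp] theorem length_results (l : List (Instr ι)) (x : ι → ℝ) :
    (results l x).length = l.length := by
  induction l using List.reverseRecOn with
  | nil => rfl
  | append_singleton l I ih => simp [results_concat, ih]

/-- The polynomial `f` can be read off by an operand after execution of the instructions `l`. -/
def Readable (l : List (Instr ι)) (f : MvPolynomial ι ℝ) : Prop :=
  ∃ a : Operand ι, ∀ (x : ι → ℝ) (regs : List ℝ),
    a.eval x (results l x ++ regs) = MvPolynomial.eval x f

theorem Readable.concat {l : List (Instr ι)} {f : MvPolynomial ι ℝ} (h : Readable l f)
    (I : Instr ι) : Readable (l ++ [I]) f := by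
  obtain ⟨a, ha⟩ := h
  exact ⟨a, fun x regs => by rw [results_concat, List.append_assoc]; exact ha x _⟩

theorem readable_last {l : List (Instr ι)} {f : MvPolynomial ι ℝ} {I : Instr ι}
    (h : ∀ x, I.eval x (results l x) = MvPolynomial.eval x f) : Readable (l ++ [I]) f := by
  refine ⟨.reg l.length, fun x regs => ?_⟩
  have h1 : l.length = (results l x).length := (length_results l x).symm
  simp only [Operand.eval, results_concat, h]
  rw [h1]
  simp

theorem exists_instr_of_isArithStep {l : List (Instr ι)} {S : Set (MvPolynomial ι ℝ)}
    (hS : ∀ s ∈ S, Readable l s) {f : MvPolynomial ι ℝ} (hf : IsArithStep S f) :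
    ∃ I : Instr ι, Readable (l ++ [I]) f := by
  have key : ∀ s ∈ S, ∃ a : Operand ι, ∀ x, a.eval x (results l x) = MvPolynomial.eval x s := by
    intro s hs
    obtain ⟨a, ha⟩ := hS s hs
    exact ⟨a, fun x => by simpa using ha x []⟩
  cases hf with
  | add ha hb =>
    obtain ⟨a, ha⟩ := key _ ha
    obtain ⟨b, hb⟩ := key _ hb
    exact ⟨.add a b, readable_last fun x => by simp [Instr.eval, ha, hb]⟩
  | sub ha hb =>
    obtain ⟨a, ha⟩ := key _ ha
    obtain ⟨b, hb⟩ := key _ hb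
    exact ⟨.sub a b, readable_last fun x => by simp [Instr.eval, ha, hb]⟩
  | mul ha hb =>
    obtain ⟨a, ha⟩ := key _ ha
    obtain ⟨b, hb⟩ := key _ hb
    exact ⟨.mul a b, readable_last fun x => by simp [Instr.eval, ha, hb]⟩

theorem exists_instrs_of_computes {n : ℕ} {S T : Set (MvPolynomial ι ℝ)} (h : Computes n S T)
    {l : List (Instr ι)} (hS : ∀ s ∈ S, Readable l s) :
    ∃ l' : List (Instr ι), l'.length ≤ l.length + n ∧ ∀ t ∈ T, Readable l' t := by
  induction h generalizing l with
  | of_subset h => exact ⟨l, Nat.le_add_right _ _, fun t ht => hS t (h ht)⟩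
  | step hx _ ih =>
    obtain ⟨I, hI⟩ := exists_instr_of_isArithStep hS hx
    obtain ⟨l', hl', h⟩ := ih (l := l ++ [I]) (by
      rintro s (rfl | hs)
      · exact hI
      · exact (hS s hs).concat I)
    refine ⟨l', ?_, h⟩
    simp only [List.length_append, List.length_singleton] at hl'
    omega

theorem exists_of_computes {n : ℕ} {f : o → MvPolynomial ι ℝ}
    (h : Computes n (insert 1 (Set.range MvPolynomial.X)) (Set.range f)) :
    ∃ P : ArithProgram ι o, P.cost ≤ n ∧ ∀ θ q, P.eval θ q = MvPolynomial.eval θ (f q) := by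
  obtain ⟨l, hl, hr⟩ := exists_instrs_of_computes h (l := []) (by
    rintro s (rfl | ⟨p, rfl⟩)
    · exact ⟨.one, fun x regs => by simp [Operand.eval]⟩
    · exact ⟨.input p, fun x regs => by simp [Operand.eval]⟩)
  choose a ha using fun q => hr (f q) ⟨q, rfl⟩
  exact ⟨⟨l, a⟩, by simpa [cost] using hl, fun θ q => by simpa [eval, run, results] using ha q θ []⟩

end ArithProgram

/-! ### Computing the inner products of the moment tensors -/

namespace Computes

open Matrix

variable {A : Type*} [CommRing A] {n m : ℕ} {S T U : Set A}

/-- Composition of computations: the second one may use everything in `S` and in `T`. -/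
theorem bind (h : Computes n S T)
    (h' : ∀ S' : Set A, S ⊆ S' → T ⊆ S' → Computes m S' U) : Computes (n + m) S U :=
  h.trans (h' _ Set.subset_union_left Set.subset_union_right)

theorem mulVec {a b : ℕ} (h0 : (0 : A) ∈ S) {M : Matrix (Fin a) (Fin b) A} {v : Fin b → A}
    (hM : ∀ i j, M i j ∈ S) (hv : ∀ j, v j ∈ S) :
    Computes (2 * a * b) S (Set.range (M *ᵥ v)) := by
  refine (range fun i => dotProduct h0 (x := M i) (y := v) ?_ ?_).mono_cost
    (by simp only [Fintype.card_fin]; exact le_of_eq (by ring))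
  · rintro _ ⟨j, rfl⟩; exact hM i j
  · rintro _ ⟨j, rfl⟩; exact hv j

theorem mul_mulVec {a b c : ℕ} (h0 : (0 : A) ∈ S) {M : Matrix (Fin a) (Fin b) A}
    {N : Matrix (Fin b) (Fin c) A} {v : Fin c → A}
    (hM : ∀ i j, M i j ∈ S) (hN : ∀ i j, N i j ∈ S) (hv : ∀ j, v j ∈ S) :
    Computes (2 * b * c + 2 * a * b) S (Set.range ((M * N) *ᵥ v)) := by
  rw [← Matrix.mulVec_mulVec]
  exact (mulVec h0 hN hv).bind fun S' hS hT =>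
    mulVec (hS h0) (fun i j => hS (hM i j)) fun j => hT ⟨j, rfl⟩

/-- The product of `V Vᵀ` with a vector, for `V` with at most `ρ` columns. -/
theorem gram_mulVec {d r ρ : ℕ} (hr : r ≤ ρ) (h0 : (0 : A) ∈ S) {V : Matrix (Fin d) (Fin r) A}
    {v : Fin d → A} (hV : ∀ i j, V i j ∈ S) (hv : ∀ j, v j ∈ S) :
    Computes (4 * (d * ρ)) S (Set.range ((V * Vᵀ) *ᵥ v)) :=
  (mul_mulVec h0 hV (fun i j => hV j i) hv).mono_cost (by
    have : d * r ≤ d * ρ := Nat.mul_le_mul_left _ hr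
    nlinarith)

theorem matrix_mul {a b c : ℕ} (h0 : (0 : A) ∈ S) {M : Matrix (Fin a) (Fin b) A}
    {N : Matrix (Fin b) (Fin c) A} (hM : ∀ i j, M i j ∈ S) (hN : ∀ i j, N i j ∈ S) :
    Computes (2 * a * b * c) S (Set.range fun p : Fin a × Fin c => (M * N) p.1 p.2) := by
  refine (range fun p : Fin a × Fin c =>
    dotProduct h0 (x := M p.1) (y := fun j => N j p.2) ?_ ?_).mono_cost
    (by simp only [Fintype.card_fin, Fintype.card_prod]; exact le_of_eq (by ring))
  · rintro _ ⟨j, rfl⟩; exact hM p.1 j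
  · rintro _ ⟨j, rfl⟩; exact hN j p.2

theorem natCast (h0 : (0 : A) ∈ S) (h1 : (1 : A) ∈ S) (N : ℕ) :
    Computes N S {x | ∃ k ≤ N, x = (k : A)} := by
  have h := iterate (n := 1) (S := S) (T := fun k => {(k : A)}) (N := N) fun k _ => by
    rw [Nat.cast_succ]
    exact add (Or.inr rfl) (Or.inl h1)
  rw [mul_one] at h
  refine (h.mono_right ?_).mono_left ?_
  · rintro _ ⟨k, hk, rfl⟩
    exact Set.mem_iUnion₂.2 ⟨k, hk, rfl⟩
  · exact Set.union_subset subset_rfl (by simpa using h0)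

end Computes

section MomentSequence

variable {A : Type*} [CommRing A]

/-- The sequence with `m_0 = 1` and `m_{n+1} = ∑_{i ≤ n} n (n-1) ⋯ (n-i+1) u_i m_{n-i}`. It turns
the normalised cumulants `u_i = κ_{i+1} / i!` of a random variable into its moments, without any
division. -/
def momentSeq (u : ℕ → A) : ℕ → A
  | 0 => 1
  | n + 1 => ∑ i : Fin (n + 1), (n.descFactorial i : A) * u i * momentSeq u (n - i)

@[simp] theorem momentSeq_zero (u : ℕ → A) : momentSeq u 0 = 1 := by rw [momentSeq]

theorem momentSeq_succ (u : ℕ → A) (n : ℕ) : momentSeq u (n + 1) =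
    ∑ i ∈ Finset.range (n + 1), (n.descFactorial i : A) * u i * momentSeq u (n - i) := by
  rw [momentSeq, Finset.sum_range fun i => (n.descFactorial i : A) * u i * momentSeq u (n - i)]

theorem map_momentSeq {B : Type*} [CommRing B] (φ : A →+* B) (u : ℕ → A) (n : ℕ) :
    φ (momentSeq u n) = momentSeq (fun i => φ (u i)) n := by
  induction n using Nat.strong_induction_on with
  | _ n ih =>
    cases n with
    | zero => simp
    | succ n =>
      rw [momentSeq_succ, momentSeq_succ, map_sum]
      refine Finset.sum_congr rfl fun i hi => ?_
      rw [map_mul, map_mul, map_natCast, ih _ (by omega)]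

/-- The partial sums of a Horner scheme for the recursion of `momentSeq`. -/
def hornerSum (u m : ℕ → A) (n r : ℕ) : A :=
  ∑ i ∈ Finset.range (r + 1), (r.descFactorial i : A) * u (n - r + i) * m (r - i)

theorem hornerSum_succ (u m : ℕ → A) {n r : ℕ} (h : r + 1 ≤ n) :
    hornerSum u m n (r + 1) =
      u (n - (r + 1)) * m (r + 1) + ((r + 1 : ℕ) : A) * hornerSum u m n r := by
  rw [hornerSum, Finset.sum_range_succ', hornerSum, Finset.mul_sum, add_comm]
  congr 1
  · simp
  · refine Finset.sum_congr rfl fun i _ => ?_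
    rw [Nat.succ_descFactorial_succ, show n - (r + 1) + (i + 1) = n - r + i by omega,
      Nat.add_sub_add_right]
    push_cast
    ring

variable {S : Set A}

theorem Computes.hornerSum {u m : ℕ → A} {n : ℕ} (hu : ∀ i ≤ n, u i ∈ S) (hm : ∀ i ≤ n, m i ∈ S)
    (hn : ∀ i ≤ n, (i : A) ∈ S) {r : ℕ} (hr : r ≤ n) :
    Computes (3 * r + 1) S {hornerSum u m n r} := by
  induction r with
  | zero =>
    have : _root_.hornerSum u m n 0 = u n * m 0 := by simp [_root_.hornerSum]
    rw [this]
    exact mul (hu n le_rfl) (hm 0 (Nat.zero_le _))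
  | succ r ih =>
    rw [hornerSum_succ u m hr, show 3 * (r + 1) + 1 = 3 * r + 1 + (1 + (1 + 1)) by ring]
    refine (ih (by omega)).bind fun S₁ h₁ hT₁ => ?_
    refine (mul (h₁ (hu _ (Nat.sub_le n (r + 1)))) (h₁ (hm _ hr))).bind fun S₂ h₂ hT₂ => ?_
    refine (mul (h₂ (h₁ (hn _ hr))) (h₂ (hT₁ rfl))).bind fun S₃ h₃ hT₃ => ?_
    exact add (h₃ (hT₂ rfl)) (hT₃ rfl)

theorem Computes.momentSeq {u : ℕ → A} {k : ℕ} (h1 : (1 : A) ∈ S) (hu : ∀ i < k, u i ∈ S)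
    (hn : ∀ i < k, (i : A) ∈ S) : Computes (3 * k ^ 2) S {momentSeq u k} := by
  have h := iterate (n := 3 * k) (S := S) (T := fun n => _root_.momentSeq u '' Set.Iic n)
    (N := k) fun n hnk => by
    have key : _root_.momentSeq u (n + 1) = _root_.hornerSum u (_root_.momentSeq u) n n := by
      simp [momentSeq_succ, _root_.hornerSum]
    have h2 := Computes.hornerSum (S := S ∪ _root_.momentSeq u '' Set.Iic n)
      (u := u) (m := _root_.momentSeq u) (n := n) (fun i hi => Or.inl (hu i (by omega)))
      (fun i hi => Or.inr ⟨i, hi, rfl⟩) (fun i hi => Or.inl (hn i (by omega))) le_rfl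
    refine (h2.union_self.mono_right ?_).mono_cost (by omega)
    rintro _ ⟨i, hi, rfl⟩
    rcases Nat.lt_or_ge n i with h3 | h3
    · rw [show i = n + 1 from le_antisymm hi h3, key]
      exact Or.inr rfl
    · exact Or.inl (Or.inr ⟨i, h3, rfl⟩)
  refine ((h.mono_right ?_).mono_left ?_).mono_cost (le_of_eq (by ring))
  · rintro _ rfl
    exact Set.mem_iUnion₂.2 ⟨k, le_rfl, ⟨k, Set.mem_Iic.2 le_rfl, rfl⟩⟩
  · rintro _ (h | ⟨i, hi, rfl⟩)
    · exact h
    · rw [Nat.le_zero.1 hi]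
      simpa using h1

end MomentSequence

section PairCoefficients

open Matrix

variable {A : Type*} [CommRing A] {d r s : ℕ}

/-- The normalised cumulants `κ_{n+1} / n!` of `⟨X, Y⟩`, for independent `X ~ N(μ, P)` and
`Y ~ N(ν, Q)`, as polynomials in the parameters. -/
def pairCoeff (μ ν : Fin d → A) (P Q : Matrix (Fin d) (Fin d) A) (n : ℕ) : A :=
  if n % 2 = 0 then ((n + 1 : ℕ) : A) * (ν ⬝ᵥ (P * Q) ^ (n / 2) *ᵥ μ)
  else ((P * Q) ^ (n / 2 + 1)).trace + ((n / 2 + 1 : ℕ) : A) *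
    (μ ⬝ᵥ (Q * (P * Q) ^ (n / 2)) *ᵥ μ + ν ⬝ᵥ ((P * Q) ^ (n / 2) * P) *ᵥ ν)

theorem pairCoeff_even (μ ν : Fin d → A) (P Q : Matrix (Fin d) (Fin d) A) (m : ℕ) :
    pairCoeff μ ν P Q (2 * m) = ((2 * m + 1 : ℕ) : A) * (ν ⬝ᵥ (P * Q) ^ m *ᵥ μ) := by
  rw [pairCoeff, if_pos (by omega), show 2 * m / 2 = m by omega]

theorem pairCoeff_odd (μ ν : Fin d → A) (P Q : Matrix (Fin d) (Fin d) A) (m : ℕ) :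
    pairCoeff μ ν P Q (2 * m + 1) = ((P * Q) ^ (m + 1)).trace + ((m + 1 : ℕ) : A) *
      (μ ⬝ᵥ (Q * (P * Q) ^ m) *ᵥ μ + ν ⬝ᵥ ((P * Q) ^ m * P) *ᵥ ν) := by
  rw [pairCoeff, if_neg (by omega), show (2 * m + 1) / 2 = m by omega]

theorem map_pairCoeff {B : Type*} [CommRing B] (φ : A →+* B) (μ ν : Fin d → A)
    (P Q : Matrix (Fin d) (Fin d) A) (n : ℕ) :
    φ (pairCoeff μ ν P Q n) = pairCoeff (φ ∘ μ) (φ ∘ ν) (P.map φ) (Q.map φ) n := by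
  have hpow : ∀ m, ((P * Q) ^ m).map φ = (P.map φ * Q.map φ) ^ m := fun m => by
    rw [← Matrix.map_mul]
    exact map_pow φ.mapMatrix (P * Q) m
  have hv : ∀ (M : Matrix (Fin d) (Fin d) A) (v : Fin d → A),
      φ ∘ (M *ᵥ v) = M.map φ *ᵥ (φ ∘ v) := fun M v => funext fun i => RingHom.map_mulVec φ M v i
  rw [pairCoeff, pairCoeff]
  split_ifs
  · rw [map_mul, map_natCast, RingHom.map_dotProduct, hv, hpow]
  · rw [map_add, map_mul, map_natCast, map_add, RingHom.map_dotProduct, RingHom.map_dotProduct, hv,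
      hv, Matrix.map_mul, Matrix.map_mul, hpow, AddMonoidHom.map_trace, hpow]

theorem Matrix.mul_pow_succ_rectangular (M : Matrix (Fin d) (Fin r) A)
    (N : Matrix (Fin r) (Fin d) A) (m : ℕ) : (M * N) ^ (m + 1) = M * (N * M) ^ m * N := by
  induction m with
  | zero => simp
  | succ m ih =>
    rw [pow_succ, ih, pow_succ]
    simp only [Matrix.mul_assoc]

/-- The trace of a power of `V Vᵀ W Wᵀ` is that of a power of a matrix of the size of the number of
columns of `V`. -/
theorem trace_pow_gram_mul_gram (V : Matrix (Fin d) (Fin r) A) (W : Matrix (Fin d) (Fin s) A)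
    (m : ℕ) : ((V * Vᵀ * (W * Wᵀ)) ^ (m + 1)).trace =
      (((Vᵀ * W) * (Vᵀ * W)ᵀ) ^ (m + 1)).trace := by
  rw [Matrix.mul_assoc V, Matrix.mul_pow_succ_rectangular, Matrix.mul_assoc, Matrix.trace_mul_comm,
    Matrix.mul_assoc, pow_succ]
  simp only [Matrix.transpose_mul, Matrix.transpose_transpose, Matrix.mul_assoc]

end PairCoefficients

section PairCost

open Matrix

variable {A : Type*} [CommRing A] {S : Set A} {d r s ρ : ℕ}

namespace Computes

theorem pow_gram_mul_gram_mulVec (hr : r ≤ ρ) (hs : s ≤ ρ) (h0 : (0 : A) ∈ S)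
    {V : Matrix (Fin d) (Fin r) A} {W : Matrix (Fin d) (Fin s) A} {v : Fin d → A}
    (hV : ∀ i j, V i j ∈ S) (hW : ∀ i j, W i j ∈ S) (hv : ∀ j, v j ∈ S) (N : ℕ) :
    Computes (N * (8 * (d * ρ))) S
      (⋃ m ≤ N, Set.range ((V * Vᵀ * (W * Wᵀ)) ^ m *ᵥ v)) := by
  have h := iterate (S := S) (N := N) (n := 8 * (d * ρ))
    (T := fun m => Set.range ((V * Vᵀ * (W * Wᵀ)) ^ m *ᵥ v)) fun m _ => by
    have h1 : (V * Vᵀ * (W * Wᵀ)) ^ (m + 1) *ᵥ v =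
        (V * Vᵀ) *ᵥ ((W * Wᵀ) *ᵥ ((V * Vᵀ * (W * Wᵀ)) ^ m *ᵥ v)) := by
      rw [pow_succ', Matrix.mulVec_mulVec, Matrix.mulVec_mulVec]
    rw [h1, show 8 * (d * ρ) = 4 * (d * ρ) + 4 * (d * ρ) by ring]
    have h0' : (0 : A) ∈ S ∪ Set.range ((V * Vᵀ * (W * Wᵀ)) ^ m *ᵥ v) := Or.inl h0
    refine (gram_mulVec hs h0' (fun i j => Or.inl (hW i j))
      fun j => Or.inr ⟨j, rfl⟩).bind fun S' h2 h3 => ?_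
    exact gram_mulVec hr (h2 h0') (fun i j => h2 (Or.inl (hV i j))) fun j => h3 ⟨j, rfl⟩
  refine h.mono_left (Set.union_subset subset_rfl ?_)
  rintro _ ⟨j, rfl⟩
  simpa using hv j

/-- Raising an `r × r` matrix to the powers `1, …, N + 1`. -/
theorem matrix_pow (hr : r ≤ ρ) (h0 : (0 : A) ∈ S) {M : Matrix (Fin r) (Fin r) A}
    (hM : ∀ i j, M i j ∈ S) (N : ℕ) :
    Computes (N * (2 * ρ ^ 3)) S
      (⋃ m ≤ N, Set.range fun p : Fin r × Fin r => (M ^ (m + 1)) p.1 p.2) := by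
  have h := iterate (S := S) (N := N) (n := 2 * ρ ^ 3)
    (T := fun m => Set.range fun p : Fin r × Fin r => (M ^ (m + 1)) p.1 p.2) fun m _ => by
    rw [pow_succ M (m + 1)]
    have h0' : (0 : A) ∈ S ∪ Set.range fun p : Fin r × Fin r => (M ^ (m + 1)) p.1 p.2 :=
      Or.inl h0
    refine (matrix_mul h0' (fun i j => Or.inr ⟨(i, j), rfl⟩)
      fun i j => Or.inl (hM i j)).mono_cost ?_
    have : r ^ 3 ≤ ρ ^ 3 := Nat.pow_le_pow_left hr 3
    nlinarith
  refine h.mono_left (Set.union_subset subset_rfl ?_)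
  rintro _ ⟨p, rfl⟩
  simpa using hM p.1 p.2

theorem trace {M : Matrix (Fin r) (Fin r) A} (h0 : (0 : A) ∈ S) (h1 : (1 : A) ∈ S)
    (hM : ∀ i j, M i j ∈ S) : Computes (2 * r) S {M.trace} := by
  have h := sum_mul h0 Finset.univ (x := fun i => M i i) (y := fun _ => 1)
    (fun i _ => hM i i) (fun _ _ => h1)
  simpa [Matrix.trace] using h

/-- The first `k` normalised cumulants take `O(k d ρ²)` operations. The powers of `V Vᵀ W Wᵀ` are
applied to vectors factor by factor, and the traces are those of powers of a `ρ × ρ` matrix, so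
that no `d × d` matrix is ever formed. -/
theorem pairCoeff (hr : r ≤ ρ) (hs : s ≤ ρ) (hρ : 1 ≤ ρ) (hρd : ρ ≤ d)
    (h0 : (0 : A) ∈ S) (h1 : (1 : A) ∈ S) {μ ν : Fin d → A}
    {V : Matrix (Fin d) (Fin r) A} {W : Matrix (Fin d) (Fin s) A}
    (hμ : ∀ j, μ j ∈ S) (hν : ∀ j, ν j ∈ S) (hV : ∀ i j, V i j ∈ S) (hW : ∀ i j, W i j ∈ S)
    {k : ℕ} (hk : 1 ≤ k) (hc : ∀ i ≤ k, (i : A) ∈ S) :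
    Computes (39 * (k * (d * ρ ^ 2))) S
      (⋃ n : Fin k, {_root_.pairCoeff μ ν (V * Vᵀ) (W * Wᵀ) n}) := by
  have hd : 1 ≤ d := hρ.trans hρd
  have e1 : d * ρ ≤ d * ρ ^ 2 := Nat.mul_le_mul_left _ (Nat.le_self_pow two_ne_zero _)
  have e2 : d ≤ d * ρ := Nat.le_mul_of_pos_right _ hρ
  have e3 : ρ ^ 3 ≤ d * ρ ^ 2 := by
    rw [pow_succ, mul_comm]; exact Nat.mul_le_mul_right _ hρd
  have e4 : d * r * s ≤ d * ρ ^ 2 := by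
    rw [mul_assoc, sq]; exact Nat.mul_le_mul_left _ (Nat.mul_le_mul hr hs)
  have e5 : r * s * r ≤ ρ ^ 3 := by
    rw [pow_succ, sq]; exact Nat.mul_le_mul (Nat.mul_le_mul hr hs) hr
  set B := d * ρ ^ 2 with hB
  have hkB : B ≤ k * B := Nat.le_mul_of_pos_left _ hk
  -- the vectors `(V Vᵀ W Wᵀ)^m μ`
  have c1 : Computes (k * (8 * B)) S
      (⋃ m ≤ k, Set.range ((V * Vᵀ * (W * Wᵀ)) ^ m *ᵥ μ)) :=
    (pow_gram_mul_gram_mulVec hr hs h0 hV hW hμ k).mono_cost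
      (Nat.mul_le_mul_left _ (by omega))
  -- the vectors `(V Vᵀ W Wᵀ)^m V Vᵀ ν`
  have c2 : Computes (4 * B + k * (8 * B)) S
      (⋃ m ≤ k, Set.range ((V * Vᵀ * (W * Wᵀ)) ^ m *ᵥ ((V * Vᵀ) *ᵥ ν))) := by
    refine ((gram_mulVec hr h0 hV hν).mono_cost (by omega)).bind fun S' g1 g2 => ?_
    exact (pow_gram_mul_gram_mulVec hr hs (g1 h0) (fun i j => g1 (hV i j))
      (fun i j => g1 (hW i j)) (fun j => g2 ⟨j, rfl⟩) k).mono_cost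
      (Nat.mul_le_mul_left _ (by omega))
  -- the powers of `Vᵀ W Wᵀ V`
  have c3 : Computes (2 * B + (2 * B + k * (2 * B))) S
      (⋃ m ≤ k, Set.range fun p : Fin r × Fin r =>
        (((Vᵀ * W) * (Vᵀ * W)ᵀ) ^ (m + 1)) p.1 p.2) := by
    refine ((matrix_mul h0 (M := Vᵀ) (N := W) (fun i j => hV j i) hW).mono_cost ?_).bind
      fun S' g1 g2 => ?_
    · nlinarith
    refine ((matrix_mul (g1 h0) (M := Vᵀ * W) (N := (Vᵀ * W)ᵀ) (fun i j => g2 ⟨(i, j), rfl⟩)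
      fun i j => g2 ⟨(j, i), rfl⟩).mono_cost ?_).bind fun S₂ g3 g4 => ?_
    · nlinarith
    exact (matrix_pow hr (g3 (g1 h0)) (fun i j => g4 ⟨(i, j), rfl⟩) k).mono_cost
      (Nat.mul_le_mul_left _ (by omega))
  refine ((c1.union (c2.union c3)).bind (m := k * (13 * B)) fun S' g1 g2 => ?_).mono_cost ?_
  swap
  · have : k * (8 * B) + (4 * B + k * (8 * B) + (2 * B + (2 * B + k * (2 * B)))) + k * (13 * B)
        = 31 * (k * B) + 8 * B := by ring
    omega
  have gp : ∀ m ≤ k, ∀ a, ((V * Vᵀ * (W * Wᵀ)) ^ m *ᵥ μ) a ∈ S' := fun m hm a =>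
    g2 (Or.inl (Set.mem_iUnion₂.2 ⟨m, hm, a, rfl⟩))
  have gq : ∀ m ≤ k, ∀ a, ((V * Vᵀ * (W * Wᵀ)) ^ m *ᵥ ((V * Vᵀ) *ᵥ ν)) a ∈ S' := fun m hm a =>
    g2 (Or.inr (Or.inl (Set.mem_iUnion₂.2 ⟨m, hm, a, rfl⟩)))
  have gt : ∀ m ≤ k, ∀ a b, (((Vᵀ * W) * (Vᵀ * W)ᵀ) ^ (m + 1)) a b ∈ S' := fun m hm a b =>
    g2 (Or.inr (Or.inr (Set.mem_iUnion₂.2 ⟨m, hm, (a, b), rfl⟩)))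
  refine (iUnion (n := 13 * B) fun n : Fin k => ?_).mono_cost (by simp)
  have hdot : ∀ {S'' : Set A} {x y : Fin d → A}, (0 : A) ∈ S'' → (∀ a, x a ∈ S'') →
      (∀ a, y a ∈ S'') → Computes (2 * B) S'' {x ⬝ᵥ y} := fun h0 hx hy =>
    (dotProduct h0 (Set.range_subset_iff.2 hx) (Set.range_subset_iff.2 hy)).mono_cost
      (by simp only [Fintype.card_fin]; omega)
  obtain ⟨m, hm⟩ := Nat.even_or_odd' (n : ℕ)
  have hn := n.2
  rcases hm with hm | hm
  · rw [hm, pairCoeff_even]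
    refine ((hdot (g1 h0) (fun a => g1 (hν a)) (gp m (by omega))).bind (m := 1)
      fun S₂ g3 g4 => ?_).mono_cost (by omega)
    exact mul (g3 (g1 (hc _ (by omega)))) (g4 rfl)
  · rw [hm, pairCoeff_odd, trace_pow_gram_mul_gram, ← Matrix.mulVec_mulVec μ (W * Wᵀ),
      ← Matrix.mulVec_mulVec ν _ (V * Vᵀ)]
    refine (Computes.bind (n := 2 * B) (m := 4 * B + (2 * B + (2 * B + (1 + (1 + 1)))))
      ((trace (g1 h0) (g1 h1) (gt m (by omega))).mono_cost (by omega))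
      fun S₂ g3 t1 => ?_).mono_cost (by omega)
    have k2 : S ⊆ S₂ := g1.trans g3
    refine ((gram_mulVec hs (k2 h0) (fun i j => k2 (hW i j))
      (fun a => g3 (gp m (by omega) a))).mono_cost (by omega)).bind fun S₃ g4 t2 => ?_
    have k3 : S ⊆ S₃ := k2.trans g4
    refine (hdot (k3 h0) (fun a => k3 (hμ a)) (fun a => t2 ⟨a, rfl⟩)).bind fun S₄ g5 t3 => ?_
    have k4 : S ⊆ S₄ := k3.trans g5
    refine (hdot (k4 h0) (fun a => k4 (hν a))
      (fun a => g5 (g4 (g3 (gq m (by omega) a))))).bind fun S₅ g6 t4 => ?_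
    refine (add (g6 (t3 rfl)) (t4 rfl)).bind fun S₆ g7 t5 => ?_
    refine (mul (g7 (g6 (k4 (hc (m + 1) (by omega))))) (t5 rfl)).bind fun S₇ g8 t6 => ?_
    exact add (g8 (g7 (g6 (g5 (g4 (t1 rfl)))))) (t6 rfl)

/-- Each inner product of the order-`k` moment tensors of two components takes
`O(k² + k d ρ²)` operations. -/
theorem momentSeq_pairCoeff (hr : r ≤ ρ) (hs : s ≤ ρ) (hρ : 1 ≤ ρ) (hρd : ρ ≤ d)
    (h0 : (0 : A) ∈ S) (h1 : (1 : A) ∈ S) {μ ν : Fin d → A}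
    {V : Matrix (Fin d) (Fin r) A} {W : Matrix (Fin d) (Fin s) A}
    (hμ : ∀ j, μ j ∈ S) (hν : ∀ j, ν j ∈ S) (hV : ∀ i j, V i j ∈ S) (hW : ∀ i j, W i j ∈ S)
    {k : ℕ} (hk : 1 ≤ k) :
    Computes (40 * (k ^ 2 + k * (d * ρ ^ 2))) S
      {_root_.momentSeq (_root_.pairCoeff μ ν (V * Vᵀ) (W * Wᵀ)) k} := by
  have hB : 1 ≤ d * ρ ^ 2 := Nat.mul_pos (hρ.trans hρd) (Nat.pow_pos hρ)
  have hkB : k ≤ k * (d * ρ ^ 2) := Nat.le_mul_of_pos_right _ hB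
  refine ((natCast h0 h1 k).bind (m := 39 * (k * (d * ρ ^ 2)) + 3 * k ^ 2)
    fun S₁ g1 t1 => ?_).mono_cost (by omega)
  have hc : ∀ i ≤ k, (i : A) ∈ S₁ := fun i hi => t1 ⟨i, hi, rfl⟩
  refine (pairCoeff hr hs hρ hρd (g1 h0) (g1 h1) (fun j => g1 (hμ j)) (fun j => g1 (hν j))
    (fun i j => g1 (hV i j)) (fun i j => g1 (hW i j)) hk hc).bind fun S₂ g2 t2 => ?_
  exact momentSeq (g2 (g1 h1)) (fun i hi => t2 (Set.mem_iUnion.2 ⟨⟨i, hi⟩, rfl⟩))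
    fun i hi => g2 (hc i hi.le)

end Computes

end PairCost

/-! ### The squared norm of the moment tensor as a polynomial -/

namespace GaussianMixture

variable {A : Type*} [CommRing A] {K d : ℕ} {R : Fin K → ℕ}

/-- The mean `μ_j` read off a parameter vector with entries in an arbitrary ring. -/
def meanOf (θ : ParamIdx K d R → A) (j : Fin K) : Fin d → A := fun a => θ (meanIdx j a)

/-- The factor `V_j` read off a parameter vector with entries in an arbitrary ring. -/
def factorOf (θ : ParamIdx K d R → A) (j : Fin K) : Matrix (Fin d) (Fin (R j)) A :=
  Matrix.of fun a r => θ (factorIdx j a r)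

/-- The covariance `V_j V_jᵀ` read off a parameter vector with entries in an arbitrary ring. -/
def covOf (θ : ParamIdx K d R → A) (j : Fin K) : Matrix (Fin d) (Fin d) A :=
  factorOf θ j * (factorOf θ j).transpose

/-- The polynomial expression in the parameters for the inner product of the order-`k` moment
tensors of the components `i` and `j`. -/
def pairMoment (θ : ParamIdx K d R → A) (i j : Fin K) (k : ℕ) : A :=
  momentSeq (pairCoeff (meanOf θ i) (meanOf θ j) (covOf θ i) (covOf θ j)) k

/-- The polynomial expression in the parameters for `α_k`. -/
def alphaOf (θ : ParamIdx K d R → A) (k : ℕ) : A :=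
  ∑ i, ∑ j, θ (weightIdx i) * θ (weightIdx j) * pairMoment θ i j k

theorem map_pairMoment {B : Type*} [CommRing B] (φ : A →+* B) (θ : ParamIdx K d R → A)
    (i j : Fin K) (k : ℕ) : φ (pairMoment θ i j k) = pairMoment (φ ∘ θ) i j k := by
  have hcov : ∀ j, (covOf θ j).map φ = covOf (φ ∘ θ) j := fun j => by
    rw [covOf, Matrix.map_mul]
    rfl
  rw [pairMoment, map_momentSeq, pairMoment]
  congr 1
  funext n
  rw [map_pairCoeff, hcov, hcov]
  rfl

theorem map_alphaOf {B : Type*} [CommRing B] (φ : A →+* B) (θ : ParamIdx K d R → A) (k : ℕ) :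
    φ (alphaOf θ k) = alphaOf (φ ∘ θ) k := by
  simp only [alphaOf, map_sum, map_mul, map_pairMoment, Function.comp_apply]

section Cost

variable {k ρ : ℕ} {S : Set A} {θ : ParamIdx K d R → A}

theorem computes_pairMoment (hk : 1 ≤ k) (hR : ∀ j, R j ≤ ρ) (hρ : 1 ≤ ρ) (hρd : ρ ≤ d)
    (h0 : (0 : A) ∈ S) (h1 : (1 : A) ∈ S) (hθ : ∀ p, θ p ∈ S) (i j : Fin K) :
    Computes (40 * (k ^ 2 + k * (d * ρ ^ 2))) S {pairMoment θ i j k} :=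
  Computes.momentSeq_pairCoeff (hR i) (hR j) hρ hρd h0 h1 (fun _ => hθ _) (fun _ => hθ _)
    (fun _ _ => hθ _) (fun _ _ => hθ _) hk

theorem computes_alphaOf (hk : 1 ≤ k) (hR : ∀ j, R j ≤ ρ) (hρ : 1 ≤ ρ) (hρd : ρ ≤ d)
    (h0 : (0 : A) ∈ S) (h1 : (1 : A) ∈ S) (hθ : ∀ p, θ p ∈ S) :
    Computes (43 * (k ^ 2 * K ^ 2 + k * K ^ 2 * d * ρ ^ 2)) S {alphaOf θ k} := by
  have hk2 : 1 ≤ k ^ 2 := Nat.pow_pos hk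
  have key : alphaOf θ k = ∑ p : Fin K × Fin K,
      (θ (weightIdx p.1) * θ (weightIdx p.2)) * pairMoment θ p.1 p.2 k := by
    rw [alphaOf, Fintype.sum_prod_type]
  rw [key]
  have c1 : Computes (K * K * (40 * (k ^ 2 + k * (d * ρ ^ 2)) + 1)) S
      (⋃ p : Fin K × Fin K,
        ({pairMoment θ p.1 p.2 k} ∪ {θ (weightIdx p.1) * θ (weightIdx p.2)})) := by
    have h := Computes.iUnion (S := S) fun p : Fin K × Fin K =>
      (computes_pairMoment hk hR hρ hρd h0 h1 hθ p.1 p.2).union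
        (Computes.mul (hθ (weightIdx p.1)) (hθ (weightIdx p.2)))
    simpa using h
  refine (c1.bind fun S' g t => Computes.sum_mul (g h0) Finset.univ
    (fun p _ => t (Set.mem_iUnion.2 ⟨p, Or.inr rfl⟩))
    (fun p _ => t (Set.mem_iUnion.2 ⟨p, Or.inl rfl⟩))).mono_cost ?_
  simp only [Finset.card_univ, Fintype.card_prod, Fintype.card_fin]
  have h2 : K * K ≤ K * K * k ^ 2 := Nat.le_mul_of_pos_right _ hk2
  have h3 : K * K * (40 * (k ^ 2 + k * (d * ρ ^ 2)) + 1) + 2 * (K * K) =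
    40 * (k ^ 2 * K ^ 2 + k * K ^ 2 * d * ρ ^ 2) + 3 * (K * K) := by ring
  have h4 : K * K * k ^ 2 = k ^ 2 * K ^ 2 := by ring
  omega

theorem computes_weight_gradient (hk : 1 ≤ k) (hR : ∀ j, R j ≤ ρ) (hρ : 1 ≤ ρ) (hρd : ρ ≤ d)
    (h0 : (0 : A) ∈ S) (h1 : (1 : A) ∈ S) (hθ : ∀ p, θ p ∈ S) (j : Fin K) :
    Computes (83 * (k ^ 2 * K + k * K * d * ρ ^ 2)) S
      {∑ i, θ (weightIdx i) * (pairMoment θ i j k + pairMoment θ j i k)} := by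
  have hk2 : 1 ≤ k ^ 2 := Nat.pow_pos hk
  have c1 : Computes (K * (40 * (k ^ 2 + k * (d * ρ ^ 2)) + 40 * (k ^ 2 + k * (d * ρ ^ 2)) + 1)) S
      (⋃ i : Fin K, {pairMoment θ i j k + pairMoment θ j i k}) := by
    have h := Computes.iUnion (S := S) fun i : Fin K =>
      ((computes_pairMoment hk hR hρ hρd h0 h1 hθ i j).union
        (computes_pairMoment hk hR hρ hρd h0 h1 hθ j i)).bind fun S' _ t =>
          Computes.add (t (Or.inl rfl)) (t (Or.inr rfl))
    simpa using h
  refine (c1.bind fun S' g t => Computes.sum_mul (g h0) Finset.univ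
    (fun i _ => g (hθ (weightIdx i)))
    (fun i _ => t (Set.mem_iUnion.2 ⟨i, rfl⟩))).mono_cost ?_
  simp only [Finset.card_univ, Fintype.card_fin]
  have h2 : K ≤ K * k ^ 2 := Nat.le_mul_of_pos_right _ hk2
  have h3 : K * (40 * (k ^ 2 + k * (d * ρ ^ 2)) + 40 * (k ^ 2 + k * (d * ρ ^ 2)) + 1) + 2 * K =
    80 * (k ^ 2 * K + k * K * d * ρ ^ 2) + 3 * K := by ring
  have h4 : K * k ^ 2 = k ^ 2 * K := by ring
  omega

end Cost

end GaussianMixture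

/-! ### Moments from integration by parts -/

section SteinRecursion

open Matrix

/-- The value at `k` of the right-hand side of the recursion of `momentSeq`. -/
def fallingConv (u m : ℕ → ℝ) (k : ℕ) : ℝ :=
  ∑ i ∈ Finset.range (k + 1), (k.descFactorial i : ℝ) * u i * m (k - i)

/-- The sequence `0, g 0, g 1, …`. -/
def shiftSeq (g : ℕ → ℝ) : ℕ → ℝ
  | 0 => 0
  | n + 1 => g n

/-- The sequence `f 0, g 0, f 1, g 1, …`. -/
def interleave (f g : ℕ → ℝ) (n : ℕ) : ℝ := if n % 2 = 0 then f (n / 2) else g (n / 2)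

theorem fallingConv_add (u v m : ℕ → ℝ) (k : ℕ) :
    fallingConv (u + v) m k = fallingConv u m k + fallingConv v m k := by
  rw [fallingConv, fallingConv, fallingConv, ← Finset.sum_add_distrib]
  exact Finset.sum_congr rfl fun i _ => by rw [Pi.add_apply]; ring

theorem fallingConv_single_zero (c : ℝ) (m : ℕ → ℝ) (k : ℕ) :
    fallingConv (Pi.single 0 c) m k = c * m k := by
  rw [fallingConv, Finset.sum_range_succ', Finset.sum_eq_zero]
  · simp
  · intro i _
    simp

theorem fallingConv_shiftSeq_zero (g m : ℕ → ℝ) : fallingConv (shiftSeq g) m 0 = 0 := by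
  simp [fallingConv, shiftSeq]

theorem fallingConv_shiftSeq_succ (g m : ℕ → ℝ) (k : ℕ) :
    fallingConv (shiftSeq g) m (k + 1) = ((k + 1 : ℕ) : ℝ) * fallingConv g m k := by
  rw [fallingConv, Finset.sum_range_succ', fallingConv, Finset.mul_sum]
  simp only [shiftSeq, mul_zero, zero_mul, add_zero]
  refine Finset.sum_congr rfl fun i _ => ?_
  rw [Nat.succ_descFactorial_succ, Nat.add_sub_add_right]
  push_cast
  ring

theorem interleave_even (f g : ℕ → ℝ) (m : ℕ) : interleave f g (2 * m) = f m := by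
  rw [interleave, if_pos (by omega), show 2 * m / 2 = m by omega]

theorem interleave_odd (f g : ℕ → ℝ) (m : ℕ) : interleave f g (2 * m + 1) = g m := by
  rw [interleave, if_neg (by omega), show (2 * m + 1) / 2 = m by omega]

theorem eq_interleave {u f g : ℕ → ℝ} (hf : ∀ m, u (2 * m) = f m)
    (hg : ∀ m, u (2 * m + 1) = g m) : u = interleave f g := by
  funext n
  obtain ⟨m, rfl | rfl⟩ := Nat.even_or_odd' n
  · rw [interleave_even, hf]
  · rw [interleave_odd, hg]

theorem shiftSeq_interleave (f g : ℕ → ℝ) :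
    shiftSeq (interleave f g) = interleave (shiftSeq g) f := by
  refine eq_interleave (fun m => ?_) fun m => ?_
  · cases m with
    | zero => rfl
    | succ m => exact interleave_odd f g m
  · exact interleave_even f g m

theorem interleave_add (f g f' g' : ℕ → ℝ) :
    interleave f g + interleave f' g' = interleave (f + f') (g + g') :=
  eq_interleave (fun m => by simp [interleave_even]) fun m => by simp [interleave_odd]

variable {𝒜 : Type*} [CommRing 𝒜] [Algebra ℝ 𝒜] {d : ℕ}

/-- The linear form with coefficients `w`, evaluated at `v`. -/
def linForm (w : Fin d → ℝ) (v : Fin d → 𝒜) : 𝒜 := ∑ a, w a • v a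

/-- The bilinear form with matrix `W`, evaluated at `u` and `v`. -/
def bilForm (W : Matrix (Fin d) (Fin d) ℝ) (u v : Fin d → 𝒜) : 𝒜 :=
  ∑ a, ∑ b, W a b • (u a * v b)

theorem bilForm_eq_sum_linForm_mul (W : Matrix (Fin d) (Fin d) ℝ) (u v : Fin d → 𝒜) :
    bilForm W u v = ∑ b, linForm (Wᵀ b) u * v b := by
  simp only [bilForm, linForm, Finset.sum_mul, smul_mul_assoc, Matrix.transpose_apply]
  exact Finset.sum_comm

theorem sum_smul_linForm (W : Matrix (Fin d) (Fin d) ℝ) (c : Fin d → ℝ) (u : Fin d → 𝒜) :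
    ∑ b, c b • linForm (Wᵀ b) u = linForm (W *ᵥ c) u := by
  simp only [linForm, Finset.smul_sum, Matrix.mulVec, dotProduct, Finset.sum_smul, smul_smul,
    Matrix.transpose_apply]
  rw [Finset.sum_comm]
  exact Finset.sum_congr rfl fun a _ => Finset.sum_congr rfl fun b _ => by rw [mul_comm]

theorem sum_linForm_mul_linForm (W P : Matrix (Fin d) (Fin d) ℝ) (u v : Fin d → 𝒜) :
    ∑ b, linForm (Wᵀ b) u * linForm (P b) v = bilForm (W * P) u v := by
  simp only [linForm, bilForm, Finset.sum_mul_sum, Matrix.mul_apply, Finset.sum_smul,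
    Matrix.transpose_apply, smul_mul_smul_comm]
  rw [Finset.sum_comm]
  exact Finset.sum_congr rfl fun a _ => Finset.sum_comm

/-- The rules of integration by parts for a linear functional `E` (an expectation) on an algebra
that contains the coordinates `x` and `y` of two independent Gaussian vectors with means `μ`, `ν`
and covariances `P`, `Q`. The derivation `D a` is the gradient with respect to `x`, contracted with
the row `a` of `P`; similarly for `D' a`, with `y` and `Q`. -/
structure IsSteinPair (E : 𝒜 →ₗ[ℝ] ℝ) (x y : Fin d → 𝒜) (μ ν : Fin d → ℝ)
    (P Q : Matrix (Fin d) (Fin d) ℝ) (D D' : Fin d → Derivation ℝ 𝒜 𝒜) : Prop where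
  symm_left : Pᵀ = P
  symm_right : Qᵀ = Q
  map_mul_left : ∀ a f, E (x a * f) = μ a * E f + E (D a f)
  map_mul_right : ∀ a f, E (y a * f) = ν a * E f + E (D' a f)
  left_left : ∀ a b, D a (x b) = algebraMap ℝ 𝒜 (P a b)
  left_right : ∀ a b, D a (y b) = 0
  right_left : ∀ a b, D' a (x b) = 0
  right_right : ∀ a b, D' a (y b) = algebraMap ℝ 𝒜 (Q a b)

namespace IsSteinPair

variable {E : 𝒜 →ₗ[ℝ] ℝ} {x y : Fin d → 𝒜} {μ ν : Fin d → ℝ} {P Q : Matrix (Fin d) (Fin d) ℝ}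
  {D D' : Fin d → Derivation ℝ 𝒜 𝒜}

theorem swap (h : IsSteinPair E x y μ ν P Q D D') : IsSteinPair E y x ν μ Q P D' D :=
  ⟨h.symm_right, h.symm_left, h.map_mul_right, h.map_mul_left, h.right_right, h.right_left,
    h.left_right, h.left_left⟩

theorem left_linForm_left (h : IsSteinPair E x y μ ν P Q D D') (a : Fin d) (w : Fin d → ℝ) :
    D a (linForm w x) = algebraMap ℝ 𝒜 (P a ⬝ᵥ w) := by
  simp only [linForm, map_sum, Derivation.map_smul, h.left_left, dotProduct, map_mul]
  exact Finset.sum_congr rfl fun _ _ => by rw [Algebra.smul_def, mul_comm]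

theorem left_linForm_right (h : IsSteinPair E x y μ ν P Q D D') (a : Fin d) (w : Fin d → ℝ) :
    D a (linForm w y) = 0 := by
  simp [linForm, h.left_right]

theorem left_dotProduct (h : IsSteinPair E x y μ ν P Q D D') (a : Fin d) :
    D a (x ⬝ᵥ y) = linForm (P a) y := by
  simp only [dotProduct, map_sum, Derivation.leibniz, h.left_left, h.left_right, smul_zero,
    zero_add, linForm]
  exact Finset.sum_congr rfl fun _ _ => by rw [smul_eq_mul, Algebra.smul_def (P a _), mul_comm]

theorem map_pow_mul_left (h : IsSteinPair E x y μ ν P Q D D') (k : ℕ) (f : 𝒜) (a : Fin d) :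
    E ((x ⬝ᵥ y) ^ k * (f * x a)) = μ a * E ((x ⬝ᵥ y) ^ k * f) +
      k * E ((x ⬝ᵥ y) ^ (k - 1) * (f * linForm (P a) y)) + E ((x ⬝ᵥ y) ^ k * D a f) := by
  rw [show (x ⬝ᵥ y) ^ k * (f * x a) = x a * ((x ⬝ᵥ y) ^ k * f) by ring, h.map_mul_left,
    Derivation.leibniz, Derivation.leibniz_pow, h.left_dotProduct, map_add, add_assoc]
  congr 1
  rw [add_comm]
  congr 1
  rw [smul_eq_mul, smul_eq_mul, mul_smul_comm, map_nsmul, nsmul_eq_mul, mul_left_comm f]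

theorem map_pow_mul_linForm_left (h : IsSteinPair E x y μ ν P Q D D') (k : ℕ) (w : Fin d → ℝ) :
    E ((x ⬝ᵥ y) ^ k * linForm w x) = (w ⬝ᵥ μ) * E ((x ⬝ᵥ y) ^ k) +
      k * E ((x ⬝ᵥ y) ^ (k - 1) * linForm (P *ᵥ w) y) := by
  have h1 : ∀ a, E ((x ⬝ᵥ y) ^ k * x a) = μ a * E ((x ⬝ᵥ y) ^ k) +
      k * E ((x ⬝ᵥ y) ^ (k - 1) * linForm (P a) y) := fun a => by
    simpa using h.map_pow_mul_left k 1 a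
  have h2 : linForm (P *ᵥ w) y = ∑ a, w a • linForm (P a) y := by
    have := sum_smul_linForm P w y
    rw [h.symm_left] at this
    exact this.symm
  have h3 : w ⬝ᵥ μ = ∑ a, w a * μ a := rfl
  rw [h2, linForm, Finset.mul_sum, Finset.mul_sum, map_sum, map_sum, Finset.mul_sum, h3,
    Finset.sum_mul, ← Finset.sum_add_distrib]
  refine Finset.sum_congr rfl fun a _ => ?_
  rw [mul_smul_comm, mul_smul_comm, map_smul, map_smul, h1, smul_eq_mul, smul_eq_mul]
  ring

theorem map_pow_mul_bilForm_right_left (h : IsSteinPair E x y μ ν P Q D D') (k : ℕ)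
    (W : Matrix (Fin d) (Fin d) ℝ) :
    E ((x ⬝ᵥ y) ^ k * bilForm W y x) = E ((x ⬝ᵥ y) ^ k * linForm (W *ᵥ μ) y) +
      k * E ((x ⬝ᵥ y) ^ (k - 1) * bilForm (W * P) y y) := by
  rw [bilForm_eq_sum_linForm_mul, ← sum_smul_linForm, ← sum_linForm_mul_linForm, Finset.mul_sum,
    Finset.mul_sum, Finset.mul_sum, map_sum, map_sum, map_sum, Finset.mul_sum,
    ← Finset.sum_add_distrib]
  refine Finset.sum_congr rfl fun b _ => ?_
  rw [h.map_pow_mul_left, h.left_linForm_right, mul_zero, map_zero, add_zero, mul_smul_comm,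
    map_smul, smul_eq_mul]

theorem map_pow_mul_bilForm_left_left (h : IsSteinPair E x y μ ν P Q D D') (k : ℕ)
    (U : Matrix (Fin d) (Fin d) ℝ) :
    E ((x ⬝ᵥ y) ^ k * bilForm U x x) = E ((x ⬝ᵥ y) ^ k * linForm (U *ᵥ μ) x) +
      (U * P).trace * E ((x ⬝ᵥ y) ^ k) +
      k * E ((x ⬝ᵥ y) ^ (k - 1) * bilForm (U * P) x y) := by
  have htr : (U * P).trace = ∑ b, P b ⬝ᵥ Uᵀ b := by
    rw [Matrix.trace_mul_comm]
    rfl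
  rw [bilForm_eq_sum_linForm_mul, ← sum_smul_linForm, ← sum_linForm_mul_linForm, htr,
    Finset.mul_sum, Finset.mul_sum, Finset.mul_sum, map_sum, map_sum, map_sum, Finset.mul_sum,
    Finset.sum_mul, ← Finset.sum_add_distrib, ← Finset.sum_add_distrib]
  refine Finset.sum_congr rfl fun b _ => ?_
  rw [h.map_pow_mul_left, h.left_linForm_left, ← Algebra.commutes, ← Algebra.smul_def, map_smul,
    mul_smul_comm, map_smul, smul_eq_mul, smul_eq_mul]
  ring

/-- The expectations of `⟨x, y⟩ ^ k ⟨w, x⟩`. -/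
theorem map_pow_mul_linForm_left_eq (h : IsSteinPair E x y μ ν P Q D D') (k : ℕ)
    (w : Fin d → ℝ) :
    E ((x ⬝ᵥ y) ^ k * linForm w x) =
      fallingConv (interleave (fun m => μ ⬝ᵥ (Q * P) ^ m *ᵥ w)
        (fun m => ν ⬝ᵥ (P * (Q * P) ^ m) *ᵥ w)) (fun j => E ((x ⬝ᵥ y) ^ j)) k := by
  induction k generalizing x y μ ν P Q D D' w with
  | zero =>
    rw [h.map_pow_mul_linForm_left]
    simp [fallingConv, interleave, dotProduct_comm]
  | succ k ih =>
    have e : interleave (fun m => μ ⬝ᵥ (Q * P) ^ m *ᵥ w) (fun m => ν ⬝ᵥ (P * (Q * P) ^ m) *ᵥ w) =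
        Pi.single 0 (w ⬝ᵥ μ) + shiftSeq (interleave (fun m => ν ⬝ᵥ (P * Q) ^ m *ᵥ (P *ᵥ w))
          (fun m => μ ⬝ᵥ (Q * (P * Q) ^ m) *ᵥ (P *ᵥ w))) := by
      have hc : ∀ m : ℕ, (P * Q) ^ m * P = P * (Q * P) ^ m := fun m => by
        induction m with
        | zero => simp
        | succ m ih =>
          rw [pow_succ', Matrix.mul_assoc, ih, pow_succ']
          simp only [Matrix.mul_assoc]
      rw [shiftSeq_interleave]
      symm
      refine eq_interleave (fun m => ?_) fun m => ?_
      · rw [Pi.add_apply, interleave_even]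
        cases m with
        | zero => simp [shiftSeq, dotProduct_comm]
        | succ m =>
          simp only [shiftSeq, Matrix.mulVec_mulVec, Matrix.mul_assoc, hc]
          rw [Pi.single_eq_of_ne (by omega), zero_add, pow_succ' (Q * P) m]
          simp only [Matrix.mul_assoc]
      · rw [Pi.add_apply, interleave_odd, Pi.single_eq_of_ne (by omega), zero_add,
          Matrix.mulVec_mulVec, hc]
    rw [h.map_pow_mul_linForm_left, e, fallingConv_add, fallingConv_single_zero,
      fallingConv_shiftSeq_succ, Nat.add_sub_cancel]
    have := ih h.swap (P *ᵥ w)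
    rw [dotProduct_comm y x] at this
    rw [this]

/-- The expectations of `⟨x, y⟩ ^ k (yᵀ (P Q)^r x)` and `⟨x, y⟩ ^ k (yᵀ (P Q)^r P y)`. Integrating
by parts with respect to `x` reduces the first ones to linear forms and to the second ones with
exponent `k - 1`; integrating by parts with respect to `y` reduces the second ones to linear forms,
traces, and the first ones with `r + 1` in place of `r`. -/
theorem map_pow_mul_bilForm_eq (h : IsSteinPair E x y μ ν P Q D D') (k r : ℕ) :
    E ((x ⬝ᵥ y) ^ k * bilForm ((P * Q) ^ r) y x) =
      fallingConv (interleave (fun m => (2 * m + 1) * (ν ⬝ᵥ (P * Q) ^ (r + m) *ᵥ μ))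
        (fun m => ((P * Q) ^ (r + m + 1)).trace + (m + 1) *
          (μ ⬝ᵥ (Q * (P * Q) ^ (r + m)) *ᵥ μ + ν ⬝ᵥ ((P * Q) ^ (r + m) * P) *ᵥ ν)))
        (fun j => E ((x ⬝ᵥ y) ^ j)) k ∧
    E ((x ⬝ᵥ y) ^ k * bilForm ((P * Q) ^ r * P) y y) =
      fallingConv (interleave (fun m => ((P * Q) ^ (r + m + 1)).trace +
          m * (μ ⬝ᵥ (Q * (P * Q) ^ (r + m)) *ᵥ μ) +
          (m + 1) * (ν ⬝ᵥ ((P * Q) ^ (r + m) * P) *ᵥ ν))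
        (fun m => (2 * m + 2) * (ν ⬝ᵥ (P * Q) ^ (r + m + 1) *ᵥ μ)))
        (fun j => E ((x ⬝ᵥ y) ^ j)) k := by
  have hlin : ∀ (k : ℕ) (w : Fin d → ℝ), E ((x ⬝ᵥ y) ^ k * linForm w y) =
      fallingConv (interleave (fun m => ν ⬝ᵥ (P * Q) ^ m *ᵥ w)
        (fun m => μ ⬝ᵥ (Q * (P * Q) ^ m) *ᵥ w)) (fun j => E ((x ⬝ᵥ y) ^ j)) k := fun k w => by
    have := h.swap.map_pow_mul_linForm_left_eq k w
    rwa [dotProduct_comm y x] at this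
  have htr : ∀ m, μ ⬝ᵥ (Q * (P * Q) ^ m * P) *ᵥ ν = ν ⬝ᵥ (P * Q) ^ (m + 1) *ᵥ μ := fun m => by
    rw [dotProduct_mulVec, dotProduct_comm, ← Matrix.mulVec_transpose]
    congr 2
    rw [Matrix.transpose_mul, Matrix.transpose_mul, Matrix.transpose_pow, Matrix.transpose_mul,
      h.symm_left, h.symm_right]
    clear hlin h
    induction m with
    | zero => simp
    | succ m ih =>
      rw [pow_succ (P * Q), ← ih, pow_succ]
      simp only [Matrix.mul_assoc]
  -- Integration by parts with respect to `x`; the hypothesis is the second claim for `k - 1`.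
  have parts_left : ∀ (k r : ℕ),
      ((k : ℝ) * E ((x ⬝ᵥ y) ^ (k - 1) * bilForm ((P * Q) ^ r * P) y y) =
        fallingConv (shiftSeq (interleave (fun m => ((P * Q) ^ (r + m + 1)).trace +
          m * (μ ⬝ᵥ (Q * (P * Q) ^ (r + m)) *ᵥ μ) +
          (m + 1) * (ν ⬝ᵥ ((P * Q) ^ (r + m) * P) *ᵥ ν))
        (fun m => (2 * m + 2) * (ν ⬝ᵥ (P * Q) ^ (r + m + 1) *ᵥ μ))))
        (fun j => E ((x ⬝ᵥ y) ^ j)) k) →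
      E ((x ⬝ᵥ y) ^ k * bilForm ((P * Q) ^ r) y x) =
      fallingConv (interleave (fun m => (2 * m + 1) * (ν ⬝ᵥ (P * Q) ^ (r + m) *ᵥ μ))
        (fun m => ((P * Q) ^ (r + m + 1)).trace + (m + 1) *
          (μ ⬝ᵥ (Q * (P * Q) ^ (r + m)) *ᵥ μ + ν ⬝ᵥ ((P * Q) ^ (r + m) * P) *ᵥ ν)))
        (fun j => E ((x ⬝ᵥ y) ^ j)) k := by
    intro k r hg
    rw [h.map_pow_mul_bilForm_right_left, hg, hlin, ← fallingConv_add, shiftSeq_interleave,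
      interleave_add]
    congr 2
    · funext m
      rw [Pi.add_apply, Matrix.mulVec_mulVec, ← pow_add, add_comm m r]
      cases m with
      | zero => simp [shiftSeq]
      | succ m =>
        simp only [shiftSeq, ← add_assoc]
        push_cast
        ring
    · funext m
      rw [Pi.add_apply, Matrix.mulVec_mulVec, Matrix.mul_assoc, ← pow_add, add_comm m r]
      ring
  -- Integration by parts with respect to `y`; the hypothesis is the first claim for `k - 1` and
  -- `r + 1`.
  have parts_right : ∀ (k r : ℕ),
      ((k : ℝ) * E ((x ⬝ᵥ y) ^ (k - 1) * bilForm ((P * Q) ^ (r + 1)) y x) =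
        fallingConv (shiftSeq (interleave
          (fun m => (2 * m + 1) * (ν ⬝ᵥ (P * Q) ^ (r + 1 + m) *ᵥ μ))
          (fun m => ((P * Q) ^ (r + 1 + m + 1)).trace + (m + 1) *
            (μ ⬝ᵥ (Q * (P * Q) ^ (r + 1 + m)) *ᵥ μ + ν ⬝ᵥ ((P * Q) ^ (r + 1 + m) * P) *ᵥ ν))))
        (fun j => E ((x ⬝ᵥ y) ^ j)) k) →
      E ((x ⬝ᵥ y) ^ k * bilForm ((P * Q) ^ r * P) y y) =
      fallingConv (interleave (fun m => ((P * Q) ^ (r + m + 1)).trace +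
          m * (μ ⬝ᵥ (Q * (P * Q) ^ (r + m)) *ᵥ μ) +
          (m + 1) * (ν ⬝ᵥ ((P * Q) ^ (r + m) * P) *ᵥ ν))
        (fun m => (2 * m + 2) * (ν ⬝ᵥ (P * Q) ^ (r + m + 1) *ᵥ μ)))
        (fun j => E ((x ⬝ᵥ y) ^ j)) k := by
    intro k r hg
    have h1 := h.swap.map_pow_mul_bilForm_left_left k ((P * Q) ^ r * P)
    rw [dotProduct_comm y x, Matrix.mul_assoc, ← pow_succ, hg, hlin,
      ← fallingConv_single_zero _ (fun j => E ((x ⬝ᵥ y) ^ j)), ← fallingConv_add,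
      ← fallingConv_add, shiftSeq_interleave] at h1
    rw [h1]
    congr 1
    refine eq_interleave (fun m => ?_) fun m => ?_
    · rw [Pi.add_apply, Pi.add_apply, interleave_even, interleave_even, Matrix.mulVec_mulVec,
        ← Matrix.mul_assoc, ← pow_add, add_comm m r]
      cases m with
      | zero => simp [shiftSeq, add_comm]
      | succ m =>
        rw [Pi.single_eq_of_ne (by omega)]
        simp only [shiftSeq, ← add_assoc, add_right_comm r 1 m]
        push_cast
        ring
    · rw [Pi.add_apply, Pi.add_apply, interleave_odd, interleave_odd, Matrix.mulVec_mulVec,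
        Pi.single_eq_of_ne (by omega), Matrix.mul_assoc, ← Matrix.mul_assoc _ _ P, ← pow_add,
        ← Matrix.mul_assoc, htr, add_comm m r, add_right_comm r 1 m]
      ring
  induction k generalizing r with
  | zero =>
    exact ⟨parts_left 0 r (by rw [fallingConv_shiftSeq_zero]; simp),
      parts_right 0 r (by rw [fallingConv_shiftSeq_zero]; simp)⟩
  | succ k ih =>
    exact ⟨parts_left (k + 1) r (by rw [fallingConv_shiftSeq_succ, Nat.add_sub_cancel, (ih r).2]),
      parts_right (k + 1) r (by rw [fallingConv_shiftSeq_succ, Nat.add_sub_cancel, (ih (r + 1)).1])⟩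

theorem map_dotProduct_pow (h : IsSteinPair E x y μ ν P Q D D') (h1 : E 1 = 1) (k : ℕ) :
    E ((x ⬝ᵥ y) ^ k) = momentSeq (pairCoeff μ ν P Q) k := by
  have hb : bilForm (1 : Matrix (Fin d) (Fin d) ℝ) y x = x ⬝ᵥ y := by
    simp [bilForm, Matrix.one_apply, dotProduct, ite_smul, mul_comm]
  have hu : pairCoeff μ ν P Q = interleave (fun m => (2 * m + 1) * (ν ⬝ᵥ (P * Q) ^ m *ᵥ μ))
        (fun m => ((P * Q) ^ (m + 1)).trace + (m + 1) *
          (μ ⬝ᵥ (Q * (P * Q) ^ m) *ᵥ μ + ν ⬝ᵥ ((P * Q) ^ m * P) *ᵥ ν)) :=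
    eq_interleave (fun m => by rw [pairCoeff_even]; push_cast; ring)
      fun m => by rw [pairCoeff_odd]; push_cast; ring
  induction k using Nat.strong_induction_on with
  | _ k ih =>
    cases k with
    | zero => simpa using h1
    | succ k =>
      have h2 := (h.map_pow_mul_bilForm_eq k 0).1
      simp only [pow_zero, hb, zero_add] at h2
      rw [pow_succ, h2, ← hu, momentSeq_succ, fallingConv]
      exact Finset.sum_congr rfl fun i _ => by rw [ih _ (by omega)]

end IsSteinPair

end SteinRecursion

/-! ### Polynomials in Gaussian variables -/

section GaussianPolynomials

open MeasureTheory ProbabilityTheory MvPolynomial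

theorem integrable_pow_gaussianReal (n : ℕ) :
    Integrable (fun x : ℝ => x ^ n) (gaussianReal 0 1) := by
  have h : (0 : ℝ) ∈ interior (integrableExpSet id (gaussianReal 0 1)) := by simp
  exact integrable_pow_of_mem_interior_integrableExpSet h n

/-- The moment generating function `f` of a standard Gaussian variable satisfies `f' = t f`; the
moments are the derivatives at zero. -/
theorem integral_pow_succ_gaussianReal (n : ℕ) :
    ∫ x : ℝ, x ^ (n + 1) ∂(gaussianReal 0 1) =
      n * ∫ x : ℝ, x ^ (n - 1) ∂(gaussianReal 0 1) := by
  have h : (0 : ℝ) ∈ interior (integrableExpSet id (gaussianReal 0 1)) := by simp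
  have hm : ∀ n, ∫ x : ℝ, x ^ n ∂(gaussianReal 0 1) =
      iteratedDeriv n (mgf id (gaussianReal 0 1)) 0 := fun n => by
    rw [iteratedDeriv_mgf_zero h]
    rfl
  have hf : mgf id (gaussianReal 0 1) = fun t => Real.exp (t ^ 2 / 2) := by
    rw [mgf_id_gaussianReal]
    simp
  have hd : deriv (mgf id (gaussianReal 0 1)) = id * mgf id (gaussianReal 0 1) := by
    rw [hf]
    funext t
    have h1 : HasDerivAt (fun t : ℝ => Real.exp (t ^ 2 / 2))
        (Real.exp (t ^ 2 / 2) * ((2 : ℕ) * t ^ (2 - 1) * 1 / 2)) t :=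
      (((hasDerivAt_id t).pow 2).div_const 2).exp
    rw [h1.deriv]
    simp
    ring
  have hs : ContDiff ℝ n (mgf id (gaussianReal 0 1)) := by
    rw [hf]; fun_prop
  rw [hm, hm, iteratedDeriv_succ', hd, iteratedDeriv_mul contDiffAt_id hs.contDiffAt]
  cases n with
  | zero => simp
  | succ n =>
    rw [Finset.sum_range_succ', Finset.sum_range_succ', Finset.sum_eq_zero]
    · simp [iteratedDeriv_id]
    · intro i _
      simp [iteratedDeriv_id]

variable {σ : Type*} [Fintype σ]

theorem integrable_eval_pi_gaussianReal (f : MvPolynomial σ ℝ) :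
    Integrable (fun z : σ → ℝ => eval z f) (Measure.pi fun _ => gaussianReal 0 1) := by
  induction f using MvPolynomial.induction_on' with
  | monomial u a =>
    simp only [eval_monomial, Finsupp.prod_fintype _ _ (fun _ => pow_zero _)]
    exact (Integrable.fintype_prod (f := fun i (x : ℝ) => x ^ u i)
      fun i => integrable_pow_gaussianReal _).const_mul a
  | add p q hp hq =>
    simp only [map_add]
    exact hp.add hq

/-- The expectation of a polynomial in independent standard Gaussian variables. -/
noncomputable def gaussianExpectation : MvPolynomial σ ℝ →ₗ[ℝ] ℝ where
  toFun f := ∫ z : σ → ℝ, eval z f ∂(Measure.pi fun _ => gaussianReal 0 1)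
  map_add' f g := by
    simp only [map_add]
    exact integral_add (integrable_eval_pi_gaussianReal f) (integrable_eval_pi_gaussianReal g)
  map_smul' c f := by
    simp only [smul_eval, RingHom.id_apply, smul_eq_mul]
    exact integral_const_mul _ _

theorem gaussianExpectation_monomial (u : σ →₀ ℕ) (a : ℝ) :
    gaussianExpectation (monomial u a) =
      a * ∏ i, ∫ x : ℝ, x ^ u i ∂(gaussianReal 0 1) := by
  change ∫ z : σ → ℝ, eval z (monomial u a) ∂(Measure.pi fun _ => gaussianReal 0 1) = _
  simp only [eval_monomial, Finsupp.prod_fintype _ _ (fun _ => pow_zero _)]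
  rw [integral_const_mul, integral_fintype_prod_eq_prod fun i (x : ℝ) => x ^ u i]

theorem gaussianExpectation_one : gaussianExpectation (1 : MvPolynomial σ ℝ) = 1 := by
  have := gaussianExpectation_monomial (0 : σ →₀ ℕ) 1
  simpa using this

/-- **Gaussian integration by parts** for polynomials. -/
theorem gaussianExpectation_X_mul (i : σ) (f : MvPolynomial σ ℝ) :
    gaussianExpectation (X i * f) = gaussianExpectation (pderiv i f) := by
  classical
  induction f using MvPolynomial.induction_on' with
  | monomial u a =>
    rw [pderiv_monomial, X, monomial_mul, one_mul, gaussianExpectation_monomial,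
      gaussianExpectation_monomial, ← Finset.mul_prod_erase _ _ (Finset.mem_univ i),
      ← Finset.mul_prod_erase _ _ (Finset.mem_univ i)]
    have h1 : ∀ j ∈ Finset.univ.erase i, (Finsupp.single i 1 + u : σ →₀ ℕ) j = u j := fun j hj => by
      simp [Finsupp.single_eq_of_ne (Finset.ne_of_mem_erase hj)]
    have h2 : ∀ j ∈ Finset.univ.erase i, (u - Finsupp.single i 1 : σ →₀ ℕ) j = u j := fun j hj => by
      simp [Finsupp.single_eq_of_ne (Finset.ne_of_mem_erase hj)]
    have h5 : ∏ j ∈ Finset.univ.erase i,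
        ∫ x : ℝ, x ^ (Finsupp.single i 1 + u : σ →₀ ℕ) j ∂(gaussianReal 0 1) =
        ∏ j ∈ Finset.univ.erase i,
        ∫ x : ℝ, x ^ (u - Finsupp.single i 1 : σ →₀ ℕ) j ∂(gaussianReal 0 1) :=
      Finset.prod_congr rfl fun j hj => by rw [h1 j hj, h2 j hj]
    have h3 : (Finsupp.single i 1 + u : σ →₀ ℕ) i = u i + 1 := by simp [add_comm]
    have h4 : (u - Finsupp.single i 1 : σ →₀ ℕ) i = u i - 1 := by simp
    rw [h5, h3, h4, integral_pow_succ_gaussianReal]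
    ring
  | add p q hp hq => rw [mul_add, map_add, map_add, map_add, hp, hq]

variable {τ : Type*} {d : ℕ}

/-- The `a`-th coordinate of `μ + A g`, as a polynomial in the standard Gaussian vector `g` whose
entries are the variables `ι b`. -/
noncomputable def affineCoord (ι : Fin d → τ) (μ : Fin d → ℝ) (A : Matrix (Fin d) (Fin d) ℝ)
    (a : Fin d) : MvPolynomial τ ℝ :=
  C (μ a) + ∑ b, A a b • X (ι b)

/-- The gradient with respect to the variables `ι b`, contracted with the row `a` of `A`. -/
noncomputable def rowDerivation (ι : Fin d → τ) (A : Matrix (Fin d) (Fin d) ℝ) (a : Fin d) :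
    Derivation ℝ (MvPolynomial τ ℝ) (MvPolynomial τ ℝ) :=
  ∑ b, A a b • pderiv (ι b)

theorem rowDerivation_apply (ι : Fin d → τ) (A : Matrix (Fin d) (Fin d) ℝ) (a : Fin d)
    (f : MvPolynomial τ ℝ) : rowDerivation ι A a f = ∑ b, A a b • pderiv (ι b) f := by
  have h : ∀ s : Finset (Fin d), (∑ b ∈ s, A a b • pderiv (ι b)) f =
      ∑ b ∈ s, A a b • pderiv (ι b) f := fun s => by
    classical
    induction s using Finset.induction_on with
    | empty => simp
    | insert b s hb ih => rw [Finset.sum_insert hb, Finset.sum_insert hb, ← ih]; rfl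
  exact h _

theorem gaussianExpectation_affineCoord_mul (ι : Fin d → σ) (μ : Fin d → ℝ)
    (A : Matrix (Fin d) (Fin d) ℝ) (a : Fin d) (f : MvPolynomial σ ℝ) :
    gaussianExpectation (affineCoord ι μ A a * f) =
      μ a * gaussianExpectation f + gaussianExpectation (rowDerivation ι A a f) := by
  rw [affineCoord, add_mul, map_add, ← smul_eq_C_mul, map_smul, smul_eq_mul, rowDerivation_apply,
    Finset.sum_mul, map_sum, map_sum]
  congr 1
  refine Finset.sum_congr rfl fun b _ => ?_
  rw [smul_mul_assoc, map_smul, gaussianExpectation_X_mul, map_smul]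

theorem rowDerivation_affineCoord_self {ι : Fin d → τ} (hι : Function.Injective ι)
    (μ : Fin d → ℝ) (A : Matrix (Fin d) (Fin d) ℝ) (a b : Fin d) :
    rowDerivation ι A a (affineCoord ι μ A b) = C ((A * A.transpose) a b) := by
  classical
  rw [rowDerivation_apply, Matrix.mul_apply, map_sum]
  refine Finset.sum_congr rfl fun c _ => ?_
  have : pderiv (ι c) (affineCoord ι μ A b) = C (A b c) := by
    rw [affineCoord, map_add, pderiv_C, zero_add, map_sum, Finset.sum_eq_single c]
    · rw [Derivation.map_smul, pderiv_X_self, smul_eq_C_mul, mul_one]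
    · intro e _ he
      rw [Derivation.map_smul, pderiv_X_of_ne (hι.ne he), smul_zero]
    · simp
  rw [this, smul_eq_C_mul, ← C_mul, Matrix.transpose_apply]

theorem rowDerivation_affineCoord_of_ne {ι ι' : Fin d → τ} (hι : ∀ a b, ι a ≠ ι' b)
    (μ : Fin d → ℝ) (A A' : Matrix (Fin d) (Fin d) ℝ) (a b : Fin d) :
    rowDerivation ι A a (affineCoord ι' μ A' b) = 0 := by
  rw [rowDerivation_apply]
  refine Finset.sum_eq_zero fun c _ => ?_
  have : pderiv (ι c) (affineCoord ι' μ A' b) = 0 := by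
    rw [affineCoord, map_add, pderiv_C, zero_add, map_sum]
    refine Finset.sum_eq_zero fun e _ => ?_
    rw [Derivation.map_smul, pderiv_X_of_ne (hι c e).symm, smul_zero]
  rw [this, smul_zero]

theorem isSteinPair_affineCoord (μ ν : Fin d → ℝ) (A B : Matrix (Fin d) (Fin d) ℝ) :
    IsSteinPair gaussianExpectation
      (affineCoord (Sum.inl : Fin d → Fin d ⊕ Fin d) μ A) (affineCoord Sum.inr ν B) μ ν
      (A * A.transpose) (B * B.transpose) (rowDerivation Sum.inl A) (rowDerivation Sum.inr B) where
  symm_left := by simp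
  symm_right := by simp
  map_mul_left := gaussianExpectation_affineCoord_mul _ _ _
  map_mul_right := gaussianExpectation_affineCoord_mul _ _ _
  left_left := rowDerivation_affineCoord_self Sum.inl_injective _ _
  left_right := rowDerivation_affineCoord_of_ne (by simp) _ _ _
  right_left := rowDerivation_affineCoord_of_ne (by simp) _ _ _
  right_right := rowDerivation_affineCoord_self Sum.inr_injective _ _

end GaussianPolynomials

/-! ### Moments of the pairing of two Gaussian vectors -/

namespace GaussianMixture

open MeasureTheory ProbabilityTheory

open scoped MatrixOrder

variable {K d : ℕ} {R : Fin K → ℕ}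

instance (θ : ParamIdx K d R → ℝ) (j : Fin K) : IsGaussian (componentLaw θ j) := by
  unfold componentLaw; infer_instance

instance (θ : ParamIdx K d R → ℝ) (i j : Fin K) : IsProbabilityMeasure (pairLaw θ i j) := by
  unfold pairLaw; infer_instance

theorem posSemidef_cov (θ : ParamIdx K d R → ℝ) (j : Fin K) : (cov θ j).PosSemidef := by
  have := Matrix.posSemidef_self_mul_conjTranspose (factor θ j)
  rwa [Matrix.conjTranspose_eq_transpose_of_trivial] at this

/-- The component law is the image of the standard Gaussian law on `ℝ^d` under `g ↦ μ + A g`, where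
`A Aᵀ = Σ`. -/
theorem exists_componentLaw_eq_map (θ : ParamIdx K d R → ℝ) (j : Fin K) :
    ∃ A : Matrix (Fin d) (Fin d) ℝ, A * A.transpose = cov θ j ∧
      componentLaw θ j = (Measure.pi fun _ : Fin d => gaussianReal 0 1).map
        fun g => WithLp.toLp 2 (mean θ j + A.mulVec g) := by
  refine ⟨CFC.sqrt (cov θ j), ?_, ?_⟩
  · have h1 : (CFC.sqrt (cov θ j)).transpose = CFC.sqrt (cov θ j) := by
      have := (CFC.sqrt_nonneg (cov θ j)).isSelfAdjoint
      rwa [IsSelfAdjoint, Matrix.star_eq_conjTranspose,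
        Matrix.conjTranspose_eq_transpose_of_trivial] at this
    rw [h1, CFC.sqrt_mul_sqrt_self _ (posSemidef_cov θ j).nonneg]
  · rw [componentLaw, multivariateGaussian, ← map_pi_eq_stdGaussian, Measure.map_map (by fun_prop)
      (by fun_prop)]
    rfl

/-- The pairing has the moments prescribed by the recursion of `momentSeq`. -/
theorem integral_pairing_pow (θ : ParamIdx K d R → ℝ) (i j : Fin K) (k : ℕ) :
    ∫ p, pairing d p ^ k ∂(pairLaw θ i j) = pairMoment θ i j k := by
  obtain ⟨A, hA, hA'⟩ := exists_componentLaw_eq_map θ i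
  obtain ⟨B, hB, hB'⟩ := exists_componentLaw_eq_map θ j
  have h := (isSteinPair_affineCoord (mean θ i) (mean θ j) A B).map_dotProduct_pow
    gaussianExpectation_one k
  rw [hA, hB] at h
  refine Eq.trans ?_ h
  have hmeas : ∀ (v : Fin d → ℝ) (A : Matrix (Fin d) (Fin d) ℝ),
      Measurable fun g : Fin d → ℝ => WithLp.toLp 2 (v + A.mulVec g) := fun v A => by
    have : Continuous fun g : Fin d → ℝ => v + A.mulVec g := by fun_prop
    exact (PiLp.continuous_toLp 2 _).measurable.comp this.measurable
  have hpair : Measurable (pairing d) := by unfold pairing; fun_prop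
  rw [pairLaw, hA', hB', Measure.map_prod_map _ _ (hmeas _ _) (hmeas _ _),
    integral_map (by exact ((hmeas _ _).prodMap (hmeas _ _)).aemeasurable)
      (hpair.pow_const k).aestronglyMeasurable,
    ← (measurePreserving_sumPiEquivProdPi
      (fun _ : Fin d ⊕ Fin d => gaussianReal 0 1)).integral_comp']
  refine integral_congr_ae (Filter.Eventually.of_forall fun z => ?_)
  simp [pairing, PiLp.inner_apply, dotProduct, affineCoord, Matrix.mulVec,
    MeasurableEquiv.coe_sumPiEquivProdPi, Equiv.sumPiEquivProdPi, mul_comm]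

end GaussianMixture

/-! ### Complete Bell polynomials -/

section Bell

/-- The exponents `(j_1, …, j_N)` with `j_1 + 2 j_2 + ⋯ + N j_N = k`. -/
def bellExponents (N k : ℕ) : Finset (Fin N → ℕ) :=
  (Fintype.piFinset fun _ : Fin N => Finset.range (k + 1)).filter
    fun j => ∑ l : Fin N, (l.val + 1) * j l = k

theorem mem_bellExponents {N k : ℕ} {j : Fin N → ℕ} :
    j ∈ bellExponents N k ↔ ∑ l : Fin N, (l.val + 1) * j l = k := by
  rw [bellExponents, Finset.mem_filter, and_iff_right_iff_imp]
  intro h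
  rw [Fintype.mem_piFinset]
  intro l
  have h1 := Finset.single_le_sum (f := fun l : Fin N => (l.val + 1) * j l)
    (fun _ _ => Nat.zero_le _) (Finset.mem_univ l)
  have h2 : j l ≤ (l.val + 1) * j l := Nat.le_mul_of_pos_left _ (Nat.succ_pos _)
  exact Finset.mem_range.2 (by omega)

/-- The coefficient of `t ^ k` in `∏_{l < N} exp (c_l t ^ (l + 1))`. -/
noncomputable def bellSum (c : ℕ → ℝ) (N k : ℕ) : ℝ :=
  ∑ j ∈ bellExponents N k, ∏ l : Fin N, c l ^ j l / (j l).factorial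

theorem completeBell_eq (k : ℕ) (x : ℕ → ℝ) : completeBell k (fun l => x l) =
    k.factorial * bellSum (fun l => x l / (l + 1).factorial) k k := by
  rw [completeBell, bellSum, Finset.mul_sum]
  refine Finset.sum_congr rfl fun j _ => ?_
  rw [Finset.prod_div_distrib]
  ring

theorem sum_update_mul {N : ℕ} (j : Fin N → ℕ) (l : Fin N) (a : ℕ) :
    ∑ i : Fin N, (i.val + 1) * Function.update j l a i =
      (l.val + 1) * a + ∑ i ∈ Finset.univ.erase l, (i.val + 1) * j i := by
  rw [← Finset.add_sum_erase _ _ (Finset.mem_univ l), Function.update_self]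
  congr 1
  exact Finset.sum_congr rfl fun i hi => by
    rw [Function.update_of_ne (Finset.ne_of_mem_erase hi)]

/-- Lowering one exponent by one. -/
theorem sum_bellExponents_mul (c : ℕ → ℝ) (N k : ℕ) (l : Fin N) :
    ∑ j ∈ bellExponents N k, (j l : ℝ) * ∏ i : Fin N, c i ^ j i / (j i).factorial =
      if l.val + 1 ≤ k then c l * bellSum c N (k - (l.val + 1)) else 0 := by
  have hsplit : ∀ j : Fin N → ℕ, ∑ i : Fin N, (i.val + 1) * j i =
      (l.val + 1) * j l + ∑ i ∈ Finset.univ.erase l, (i.val + 1) * j i := fun j =>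
    (Finset.add_sum_erase _ _ (Finset.mem_univ l)).symm
  split_ifs with hl
  · rw [← Finset.sum_filter_of_ne (p := fun j => j l ≠ 0) (fun j _ h h0 => h (by simp [h0])),
      bellSum, Finset.mul_sum]
    refine Finset.sum_nbij' (fun j => Function.update j l (j l - 1))
      (fun j => Function.update j l (j l + 1)) ?_ ?_ ?_ ?_ ?_
    · intro j hj
      rw [Finset.mem_filter, mem_bellExponents, hsplit] at hj
      rw [mem_bellExponents, sum_update_mul]
      obtain ⟨a, ha⟩ := Nat.exists_eq_succ_of_ne_zero hj.2
      rw [ha, Nat.succ_eq_add_one, mul_add] at hj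
      rw [ha, Nat.succ_sub_one]
      omega
    · intro j hj
      rw [mem_bellExponents, hsplit] at hj
      rw [Finset.mem_filter, mem_bellExponents, sum_update_mul, Function.update_self, mul_add]
      exact ⟨by omega, Nat.succ_ne_zero _⟩
    · intro j hj
      have := (Finset.mem_filter.1 hj).2
      simp [Nat.sub_add_cancel (Nat.pos_of_ne_zero this)]
    · intro j _
      simp
    · intro j hj
      obtain ⟨a, ha⟩ := Nat.exists_eq_succ_of_ne_zero (Finset.mem_filter.1 hj).2
      rw [← Finset.mul_prod_erase _ _ (Finset.mem_univ l),
        ← Finset.mul_prod_erase _ _ (Finset.mem_univ l), Function.update_self]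
      have h1 : ∏ i ∈ Finset.univ.erase l, c i ^ Function.update j l (j l - 1) i /
          (Function.update j l (j l - 1) i).factorial =
          ∏ i ∈ Finset.univ.erase l, c i ^ j i / (j i).factorial :=
        Finset.prod_congr rfl fun i hi => by
          rw [Function.update_of_ne (Finset.ne_of_mem_erase hi)]
      rw [h1, ha, Nat.succ_sub_one, Nat.factorial_succ, Nat.succ_eq_add_one, pow_succ]
      have h2 : ((a + 1 : ℕ) : ℝ) ≠ 0 := by positivity
      push_cast at h2 ⊢
      field_simp
  · refine Finset.sum_eq_zero fun j hj => ?_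
    rw [mem_bellExponents, hsplit] at hj
    have : j l = 0 := by
      by_contra h
      have := Nat.le_mul_of_pos_right (l.val + 1) (Nat.pos_of_ne_zero h)
      omega
    simp [this]

/-- The recursion for the coefficients of the exponential of a power series. -/
theorem natCast_mul_bellSum (c : ℕ → ℝ) (N k : ℕ) : (k : ℝ) * bellSum c N k =
    ∑ l : Fin N, if l.val + 1 ≤ k then ((l.val + 1 : ℕ) : ℝ) *
      (c l * bellSum c N (k - (l.val + 1))) else 0 := by
  have h1 : ∀ j ∈ bellExponents N k, (k : ℝ) * ∏ i : Fin N, c i ^ j i / (j i).factorial =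
      ∑ l : Fin N, ((l.val + 1 : ℕ) : ℝ) *
        ((j l : ℝ) * ∏ i : Fin N, c i ^ j i / (j i).factorial) := fun j hj => by
    conv_lhs => rw [← mem_bellExponents.1 hj]
    rw [Nat.cast_sum, Finset.sum_mul]
    exact Finset.sum_congr rfl fun l _ => by rw [Nat.cast_mul, mul_assoc]
  rw [bellSum, Finset.mul_sum, Finset.sum_congr rfl h1, Finset.sum_comm]
  refine Finset.sum_congr rfl fun l _ => ?_
  rw [← Finset.mul_sum, sum_bellExponents_mul]
  split_ifs <;> simp

/-- The exponent of a variable of weight larger than `k` vanishes. -/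
theorem bellSum_succ_left (c : ℕ → ℝ) {N k : ℕ} (h : k ≤ N) :
    bellSum c (N + 1) k = bellSum c N k := by
  have hlast : ∀ j ∈ bellExponents (N + 1) k, j (Fin.last N) = 0 := fun j hj => by
    rw [mem_bellExponents, Fin.sum_univ_castSucc, Fin.val_last] at hj
    by_contra h0
    have := Nat.le_mul_of_pos_right (N + 1) (Nat.pos_of_ne_zero h0)
    omega
  refine Finset.sum_nbij' (fun j l => j l.castSucc) (fun j => Fin.snoc j 0) ?_ ?_ ?_ ?_ ?_
  · intro j hj
    have h1 := hlast j hj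
    rw [mem_bellExponents, Fin.sum_univ_castSucc, h1] at hj
    rw [mem_bellExponents]
    simpa using hj
  · intro j hj
    rw [mem_bellExponents] at hj ⊢
    rw [Fin.sum_univ_castSucc]
    simpa using hj
  · intro j hj
    have h1 := hlast j hj
    funext l
    refine Fin.lastCases ?_ (fun l => ?_) l
    · simp [h1]
    · simp
  · intro j _
    simp
  · intro j hj
    rw [Fin.prod_univ_castSucc, hlast j hj]
    simp

theorem bellSum_eq_of_le (c : ℕ → ℝ) {N k : ℕ} (h : k ≤ N) : bellSum c N k = bellSum c k k := by
  induction N, h using Nat.le_induction with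
  | base => rfl
  | succ N hN ih => rw [bellSum_succ_left c hN, ih]

/-- The complete Bell polynomials turn cumulants into moments. -/
theorem completeBell_eq_momentSeq (k : ℕ) (x : ℕ → ℝ) :
    completeBell k (fun l => x l) = momentSeq (fun i => x i / i.factorial) k := by
  induction k using Nat.strong_induction_on with
  | _ k ih =>
    cases k with
    | zero => simp [completeBell]
    | succ k =>
      rw [completeBell_eq, Nat.factorial_succ, Nat.cast_mul, mul_comm ((k + 1 : ℕ) : ℝ), mul_assoc,
        natCast_mul_bellSum, momentSeq_succ, Finset.mul_sum, Finset.sum_range]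
      refine Finset.sum_congr rfl fun l _ => ?_
      have hl : l.val ≤ k := Nat.lt_succ_iff.1 l.2
      rw [if_pos (by omega), ← ih (k - l) (by omega), completeBell_eq, Nat.add_sub_add_right,
        bellSum_eq_of_le _ (by omega : k - l.val ≤ k + 1), Nat.factorial_succ,
        ← Nat.factorial_mul_descFactorial hl]
      have h1 : ((l.val + 1 : ℕ) : ℝ) ≠ 0 := by positivity
      have h2 : (l.val.factorial : ℝ) ≠ 0 := by positivity
      push_cast at h1 ⊢
      field_simp

end Bell

/-! ### Cumulants -/

section Cumulants

open MeasureTheory ProbabilityTheory Filter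

/-- The recursion of `momentSeq` determines its coefficients from the moments. -/
theorem momentSeq_injective {u v : ℕ → ℝ} (h : ∀ n, momentSeq u n = momentSeq v n) : u = v := by
  funext n
  induction n using Nat.strong_induction_on with
  | _ n ih =>
    have h1 := h (n + 1)
    rw [momentSeq_succ, momentSeq_succ, Finset.sum_range_succ, Finset.sum_range_succ,
      Finset.sum_congr rfl fun i hi => by rw [ih i (Finset.mem_range.1 hi), h (n - i)]] at h1
    simpa [Nat.factorial_ne_zero] using h1

/-- The moments of a random variable are obtained from its cumulants by the recursion of
`momentSeq`. This is the `n`-th derivative at zero of `M' = M (log M)'`, where `M` is the moment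
generating function. -/
theorem integral_pow_eq_momentSeq_cumulant {Ω : Type*} [MeasurableSpace Ω] {P : Measure Ω}
    [IsProbabilityMeasure P] {X : Ω → ℝ} (h : (0 : ℝ) ∈ interior (integrableExpSet X P)) (n : ℕ) :
    ∫ ω, X ω ^ n ∂P =
      momentSeq (fun i => GaussianMixture.cumulant (i + 1) X P / i.factorial) n := by
  have hm : ∀ n, ∫ ω, X ω ^ n ∂P = iteratedDeriv n (mgf X P) 0 := fun n => by
    rw [iteratedDeriv_mgf_zero h]
    rfl
  have hd : deriv (mgf X P) =ᶠ[nhds 0] deriv (cgf X P) * mgf X P := by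
    filter_upwards [isOpen_interior.mem_nhds h] with t ht
    rw [Pi.mul_apply, deriv_cgf ht, deriv_mgf ht,
      div_mul_cancel₀ _ (mgf_pos (interior_subset (s := integrableExpSet X P) ht)).ne']
  induction n using Nat.strong_induction_on with
  | _ n ih =>
    cases n with
    | zero => simp
    | succ n =>
      rw [hm, iteratedDeriv_succ', hd.iteratedDeriv_eq,
        iteratedDeriv_mul (analyticAt_cgf h).deriv.contDiffAt (analyticAt_mgf h).contDiffAt,
        momentSeq_succ]
      refine Finset.sum_congr rfl fun i hi => ?_
      rw [← hm, ih _ (by omega), ← iteratedDeriv_succ', GaussianMixture.cumulant,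
        Nat.descFactorial_eq_factorial_mul_choose]
      have : (i.factorial : ℝ) ≠ 0 := by positivity
      push_cast
      field_simp

end Cumulants

/-! ### Moment tensors of Gaussian mixtures -/

namespace GaussianMixture

open MeasureTheory ProbabilityTheory Filter

variable {K d : ℕ} {R : Fin K → ℕ}

/-- The moment generating function of the pairing is finite near zero: by Fernique's theorem
`exp (a ‖X‖²)` and `exp (b ‖Y‖²)` are integrable for some `a, b > 0`, and `|⟨X, Y⟩|` is at most
`‖X‖² + ‖Y‖²`. -/
theorem zero_mem_interior_integrableExpSet_pairing (θ : ParamIdx K d R → ℝ) (i j : Fin K) :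
    (0 : ℝ) ∈ interior (integrableExpSet (pairing d) (pairLaw θ i j)) := by
  obtain ⟨a, ha, hi⟩ := IsGaussian.exists_integrable_exp_sq (componentLaw θ i)
  obtain ⟨b, hb, hj⟩ := IsGaussian.exists_integrable_exp_sq (componentLaw θ j)
  have hc : 0 < min a b := lt_min ha hb
  rw [mem_interior_iff_mem_nhds]
  filter_upwards [Ioo_mem_nhds (neg_lt_zero.2 hc) hc] with t ht
  have hp := hi.mul_prod hj
  have hpair : Continuous (pairing d) := by unfold pairing; fun_prop
  refine hp.mono' (by fun_prop) (ae_of_all _ fun p => ?_)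
  rw [Real.norm_eq_abs, Real.abs_exp, ← Real.exp_add, Real.exp_le_exp]
  have h1 : |pairing d p| ≤ ‖p.1‖ * ‖p.2‖ := abs_real_inner_le_norm _ _
  have h2 : |t| ≤ min a b := (abs_lt.2 ht).le
  calc t * pairing d p ≤ |t * pairing d p| := le_abs_self _
    _ = |t| * |pairing d p| := abs_mul _ _
    _ ≤ min a b * (‖p.1‖ * ‖p.2‖) := by gcongr
    _ ≤ min a b * (‖p.1‖ ^ 2 + ‖p.2‖ ^ 2) := by
        gcongr
        nlinarith [sq_nonneg (‖p.1‖ - ‖p.2‖), sq_nonneg ‖p.1‖, sq_nonneg ‖p.2‖]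
    _ = min a b * ‖p.1‖ ^ 2 + min a b * ‖p.2‖ ^ 2 := mul_add _ _ _
    _ ≤ a * ‖p.1‖ ^ 2 + b * ‖p.2‖ ^ 2 := by
        gcongr
        · exact min_le_left _ _
        · exact min_le_right _ _

theorem integrable_prod_componentLaw (θ : ParamIdx K d R → ℝ) (j : Fin K) {k : ℕ}
    (a : Fin k → Fin d) :
    Integrable (fun y : EuclideanSpace ℝ (Fin d) => ∏ l, y (a l)) (componentLaw θ j) := by
  have h := (IsGaussian.memLp_id (componentLaw θ j) k (by simp)).integrable_norm_pow'
  refine h.mono' (by fun_prop) (ae_of_all _ fun y => ?_)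
  rw [norm_prod, id]
  calc ∏ l, ‖y (a l)‖ ≤ ∏ _l : Fin k, ‖y‖ :=
        Finset.prod_le_prod (fun _ _ => norm_nonneg _) fun l _ => PiLp.norm_apply_le y (a l)
    _ = ‖y‖ ^ k := by simp

theorem integrable_prod_mixtureLaw (θ : ParamIdx K d R → ℝ) {k : ℕ} (a : Fin k → Fin d) :
    Integrable (fun y : EuclideanSpace ℝ (Fin d) => ∏ l, y (a l)) (mixtureLaw θ) :=
  integrable_finsetSum_measure.2 fun j _ =>
    (integrable_prod_componentLaw θ j a).smul_measure ENNReal.ofReal_ne_top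

theorem inner_momentTensor_componentLaw (θ : ParamIdx K d R → ℝ) (i j : Fin K) (k : ℕ) :
    inner ℝ (momentTensor k (componentLaw θ i)) (momentTensor k (componentLaw θ j)) =
      pairMoment θ i j k := by
  rw [← integral_pairing_pow]
  have h1 : ∀ p : EuclideanSpace ℝ (Fin d) × EuclideanSpace ℝ (Fin d), pairing d p ^ k =
      ∑ a : Fin k → Fin d, (∏ l, p.1 (a l)) * ∏ l, p.2 (a l) := fun p => by
    simp only [pairing, PiLp.inner_apply, RCLike.inner_apply, conj_trivial]
    rw [Fintype.sum_pow]
    exact Finset.sum_congr rfl fun a _ => by rw [Finset.prod_mul_distrib, mul_comm]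
  simp only [h1]
  rw [integral_finsetSum]
  · simp only [momentTensor, PiLp.inner_apply, RCLike.inner_apply, conj_trivial, pairLaw]
    refine Finset.sum_congr rfl fun a _ => ?_
    rw [integral_prod_mul (fun x : EuclideanSpace ℝ (Fin d) => ∏ l, x (a l))
      (fun y : EuclideanSpace ℝ (Fin d) => ∏ l, y (a l)), mul_comm]
  · intro a _
    exact (integrable_prod_componentLaw θ i a).mul_prod (integrable_prod_componentLaw θ j a)

/-- Positivity of the weights matters: `mixtureLaw` replaces negative weights by zero. -/
theorem momentTensor_mixtureLaw {θ : ParamIdx K d R → ℝ} (hθ : ∀ j, 0 < weight θ j) (k : ℕ) :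
    momentTensor k (mixtureLaw θ) = ∑ j, weight θ j • momentTensor k (componentLaw θ j) := by
  ext a
  rw [WithLp.ofLp_sum, Finset.sum_apply]
  simp only [momentTensor, PiLp.smul_apply, smul_eq_mul, mixtureLaw]
  rw [integral_finsetSum_measure fun j _ =>
    (integrable_prod_componentLaw θ j a).smul_measure ENNReal.ofReal_ne_top]
  refine Finset.sum_congr rfl fun j _ => ?_
  rw [integral_smul_measure, ENNReal.toReal_ofReal (hθ j).le, smul_eq_mul]

theorem alpha_eq_sum_inner {θ : ParamIdx K d R → ℝ} (hθ : ∀ j, 0 < weight θ j) (k : ℕ) :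
    alpha k θ = ∑ i, ∑ j, weight θ i * weight θ j *
      inner ℝ (momentTensor k (componentLaw θ i)) (momentTensor k (componentLaw θ j)) := by
  rw [alpha, momentTensor_mixtureLaw hθ, ← real_inner_self_eq_norm_sq, sum_inner]
  refine Finset.sum_congr rfl fun i _ => ?_
  rw [inner_sum]
  refine Finset.sum_congr rfl fun j _ => ?_
  rw [real_inner_smul_left, real_inner_smul_right, mul_assoc]

theorem alpha_eq_alphaOf {θ : ParamIdx K d R → ℝ} (hθ : ∀ j, 0 < weight θ j) (k : ℕ) :
    alpha k θ = alphaOf θ k := by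
  rw [alpha_eq_sum_inner hθ]
  simp only [inner_momentTensor_componentLaw]
  rfl

theorem completeBell_kappa (θ : ParamIdx K d R → ℝ) (i j : Fin K) (k : ℕ) :
    completeBell k (fun l => kappa θ i j (l.val + 1)) = pairMoment θ i j k := by
  rw [completeBell_eq_momentSeq k fun l => kappa θ i j (l + 1), ← integral_pairing_pow,
    integral_pow_eq_momentSeq_cumulant (zero_mem_interior_integrableExpSet_pairing θ i j)]
  rfl

/-- Both the cumulants and the coefficients `pairCoeff` produce the moments of the pairing by the
recursion of `momentSeq`, so they agree up to the normalisation by `n!`. -/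
theorem kappa_succ (θ : ParamIdx K d R → ℝ) (i j : Fin K) (n : ℕ) :
    kappa θ i j (n + 1) =
      n.factorial * pairCoeff (mean θ i) (mean θ j) (cov θ i) (cov θ j) n := by
  have h : (fun n => kappa θ i j (n + 1) / n.factorial) =
      pairCoeff (mean θ i) (mean θ j) (cov θ i) (cov θ j) := momentSeq_injective fun k => by
    rw [← completeBell_eq_momentSeq k fun l => kappa θ i j (l + 1)]
    exact completeBell_kappa θ i j k
  rw [← h, mul_div_cancel₀]
  positivity

theorem kappa_odd (θ : ParamIdx K d R → ℝ) (i j : Fin K) (m : ℕ) :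
    kappa θ i j (2 * m + 1) = ((2 * m + 1).factorial : ℝ) *
      (mean θ j ⬝ᵥ ((cov θ i * cov θ j) ^ m).mulVec (mean θ i)) := by
  rw [kappa_succ, pairCoeff_even, Nat.factorial_succ]
  push_cast
  ring

theorem kappa_even (θ : ParamIdx K d R → ℝ) (i j : Fin K) (m : ℕ) :
    kappa θ i j (2 * m + 2) =
      ((2 * m + 1).factorial : ℝ) * ((cov θ i * cov θ j) ^ (m + 1)).trace +
      ((2 * m + 2).factorial : ℝ) / 2 *
        (mean θ i ⬝ᵥ (cov θ j * (cov θ i * cov θ j) ^ m).mulVec (mean θ i)) +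
      ((2 * m + 2).factorial : ℝ) / 2 *
        (mean θ j ⬝ᵥ ((cov θ i * cov θ j) ^ m * cov θ i).mulVec (mean θ j)) := by
  rw [kappa_succ, pairCoeff_odd, Nat.factorial_succ (2 * m + 1)]
  push_cast
  ring

end GaussianMixture

/-! ### Gradients -/

section PolynomialDerivatives

open MvPolynomial

theorem MvPolynomial.exists_hasFDerivAt_eval {ι : Type*} [Fintype ι] [DecidableEq ι]
    (f : MvPolynomial ι ℝ) (θ : ι → ℝ) :
    ∃ L : (ι → ℝ) →L[ℝ] ℝ, HasFDerivAt (fun x : ι → ℝ => eval x f) L θ ∧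
      ∀ p, L (Pi.single p 1) = eval θ (pderiv p f) := by
  induction f using MvPolynomial.induction_on with
  | C a => exact ⟨0, by simpa using hasFDerivAt_const a θ, by simp⟩
  | add f g hf hg =>
    obtain ⟨L, hL, hL'⟩ := hf
    obtain ⟨M, hM, hM'⟩ := hg
    exact ⟨L + M, by simp only [map_add]; exact hL.add hM, fun p => by simp [hL', hM']⟩
  | mul_X f i hf =>
    obtain ⟨L, hL, hL'⟩ := hf
    have hX : HasFDerivAt (fun x : ι → ℝ => x i)
        (ContinuousLinearMap.proj (R := ℝ) (φ := fun _ : ι => ℝ) i) θ := hasFDerivAt_apply i θ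
    refine ⟨_, by simp only [map_mul, eval_X]; exact hL.mul hX, fun p => ?_⟩
    rw [pderiv_mul, pderiv_X]
    simp only [add_apply, smul_apply, hL',
      ContinuousLinearMap.proj_apply, smul_eq_mul, eval_add, eval_mul, eval_X, Pi.single_apply]
    rw [add_comm, mul_comm (θ i)]
    by_cases h : p = i
    · subst h; simp
    · simp [Ne.symm h]

theorem MvPolynomial.pderiv_rename_of_notMem_range {σ τ : Type*} {ι : τ → σ} {p : σ}
    (hp : p ∉ Set.range ι) (f : MvPolynomial τ ℝ) : pderiv p (rename ι f) = 0 := by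
  classical
  refine pderiv_eq_zero_of_notMem_vars fun h => ?_
  obtain ⟨q, _, hq⟩ := Finset.mem_image.1 (vars_rename ι f h)
  exact hp ⟨q, hq⟩

/-- All partial derivatives of a polynomial, at five times the cost of the polynomial. -/
theorem Computes.range_pderiv {ι κ : Type*} {n : ℕ} {f : MvPolynomial ι ℝ}
    (h : Computes n (insert 0 (insert 1 (Set.range X))) {f}) (p : κ → ι) :
    Computes (5 * n) (insert 0 (insert 1 (Set.range X))) (Set.range fun q => pderiv (p q) f) := by
  classical
  obtain ⟨c, hcS, hcD, hc⟩ := h.exists_gradient ℝ (by simp) (by simp)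
  refine hc.mono_right ?_
  rintro _ ⟨q, rfl⟩
  refine ⟨X (p q), ?_⟩
  simp only [hcD, Finsupp.sum]
  rw [Finset.sum_eq_single (X (p q))]
  · simp
  · intro s hs hne
    rcases hcS hs with rfl | rfl | ⟨r, rfl⟩
    · simp
    · simp
    · rw [pderiv_X_of_ne (fun h => hne (by rw [h])), mul_zero]
  · intro h
    rw [Finsupp.notMem_support_iff.1 h, zero_mul]

/-- The constant zero is obtained as `1 - 1`. -/
theorem ArithProgram.exists_of_computes_insert_zero {ι o : Type} {n : ℕ}
    {f : o → MvPolynomial ι ℝ}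
    (h : Computes n (insert 0 (insert 1 (Set.range X))) (Set.range f)) :
    ∃ P : ArithProgram ι o, P.cost ≤ n + 1 ∧ ∀ θ q, P.eval θ q = MvPolynomial.eval θ (f q) := by
  refine ArithProgram.exists_of_computes (Computes.step (x := 0) ?_ h)
  have h1 : (1 : MvPolynomial ι ℝ) ∈ insert 1 (Set.range (X : ι → MvPolynomial ι ℝ)) :=
    Set.mem_insert _ _
  simpa using IsArithStep.sub h1 h1

end PolynomialDerivatives

namespace GaussianMixture

open MvPolynomial

variable {K d : ℕ} {R : Fin K → ℕ}

theorem eval_alphaOf_X (θ : ParamIdx K d R → ℝ) (k : ℕ) :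
    eval θ (alphaOf X k) = alphaOf θ k := by
  rw [map_alphaOf]
  congr 1
  funext p
  simp

theorem alpha_eventuallyEq {θ : ParamIdx K d R → ℝ} (hθ : ∀ j, 0 < weight θ j) (k : ℕ) :
    (fun θ' : ParamIdx K d R → ℝ => alpha k θ') =ᶠ[nhds θ] fun θ' => eval θ' (alphaOf X k) := by
  have h : ∀ᶠ θ' in nhds θ, ∀ j, 0 < weight θ' j := by
    rw [Filter.eventually_all]
    exact fun j => (continuous_apply (weightIdx j)).continuousAt.eventually (lt_mem_nhds (hθ j))
  filter_upwards [h] with θ' h'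
  rw [alpha_eq_alphaOf h', eval_alphaOf_X]

theorem differentiableAt_alpha {θ : ParamIdx K d R → ℝ} (hθ : ∀ j, 0 < weight θ j) (k : ℕ) :
    DifferentiableAt ℝ (fun θ' : ParamIdx K d R → ℝ => alpha k θ') θ := by
  obtain ⟨L, hL, -⟩ := exists_hasFDerivAt_eval (alphaOf X k) θ
  exact (hL.congr_of_eventuallyEq (alpha_eventuallyEq hθ k)).differentiableAt

theorem partialAlpha_eq {θ : ParamIdx K d R → ℝ} (hθ : ∀ j, 0 < weight θ j) (k : ℕ)
    (p : ParamIdx K d R) : partialAlpha k θ p = eval θ (pderiv p (alphaOf X k)) := by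
  obtain ⟨L, hL, hL'⟩ := exists_hasFDerivAt_eval (alphaOf X k) θ
  have h := (hL.congr_of_eventuallyEq (alpha_eventuallyEq hθ k)).fderiv
  rw [partialAlpha, h, hL']

/-- The inner products of the moment tensors of the components do not involve the weights. -/
theorem pderiv_weightIdx_pairMoment (l i j : Fin K) (k : ℕ) :
    pderiv (weightIdx l) (pairMoment (X : ParamIdx K d R → MvPolynomial _ ℝ) i j k) = 0 := by
  let η : ParamIdx K d R →
      MvPolynomial ((Fin K × Fin d) ⊕ (Σ j : Fin K, Fin d × Fin (R j))) ℝ :=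
    Sum.elim (fun _ => 0) X
  have h1 : pairMoment (X : ParamIdx K d R → MvPolynomial _ ℝ) i j k =
      pairMoment ((rename Sum.inr).toRingHom ∘ η) i j k := by
    have hm : ∀ j, meanOf (X : ParamIdx K d R → MvPolynomial _ ℝ) j =
        meanOf ((rename Sum.inr).toRingHom ∘ η) j := fun j => by
      funext a
      simp [meanOf, meanIdx, η]
    have hf : ∀ j, factorOf (X : ParamIdx K d R → MvPolynomial _ ℝ) j =
        factorOf ((rename Sum.inr).toRingHom ∘ η) j := fun j => by
      ext1 a r
      simp [factorOf, factorIdx, η]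
    simp only [pairMoment, covOf, hm, hf]
  rw [h1, ← map_pairMoment]
  exact pderiv_rename_of_notMem_range (by simp [weightIdx]) _

theorem pderiv_weightIdx_alphaOf (l : Fin K) (k : ℕ) :
    pderiv (weightIdx l) (alphaOf (X : ParamIdx K d R → MvPolynomial _ ℝ) k) =
      ∑ i, X (weightIdx i) * (pairMoment X i l k + pairMoment X l i k) := by
  classical
  have hX : ∀ i, pderiv (weightIdx l) (X (weightIdx i) : MvPolynomial (ParamIdx K d R) ℝ) =
      if i = l then 1 else 0 := fun i => by
    rw [pderiv_X, Pi.single_apply]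
    simp [weightIdx]
  simp only [alphaOf, map_sum, pderiv_mul, pderiv_weightIdx_pairMoment, hX, mul_zero, add_zero,
    add_mul, mul_ite, ite_mul, mul_one, one_mul, zero_mul, Finset.sum_add_distrib, mul_add]
  simp only [Finset.sum_ite_eq', Finset.mem_univ, if_true]
  rw [Finset.sum_comm]
  simp only [Finset.sum_ite_eq', Finset.mem_univ, if_true]
  rw [add_comm]

end GaussianMixture

open GaussianMixture in
theorem mainTheorem3 :
    (∀ (k K d : ℕ) (R : Fin K → ℕ) (θ : ParamIdx K d R → ℝ), IsMixtureParam θ →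
      (∀ i : Fin k → Fin d,
        MeasureTheory.Integrable (fun y : EuclideanSpace ℝ (Fin d) => ∏ l, y (i l))
          (mixtureLaw θ)) ∧
      (∀ i j : Fin K,
        (0 : ℝ) ∈ interior (ProbabilityTheory.integrableExpSet (pairing d) (pairLaw θ i j))) ∧
      alpha k θ = ∑ i, ∑ j, weight θ i * weight θ j *
        inner ℝ (momentTensor k (componentLaw θ i)) (momentTensor k (componentLaw θ j)) ∧
      alpha k θ = ∑ i, ∑ j, weight θ i * weight θ j *
        completeBell k (fun l => kappa θ i j (l.val + 1)) ∧
      (∀ (i j : Fin K) (m : ℕ),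
        kappa θ i j (2 * m + 1) = ((2 * m + 1).factorial : ℝ) *
          (mean θ j ⬝ᵥ ((cov θ i * cov θ j) ^ m).mulVec (mean θ i)) ∧
        kappa θ i j (2 * m + 2) =
          ((2 * m + 1).factorial : ℝ) * ((cov θ i * cov θ j) ^ (m + 1)).trace +
          ((2 * m + 2).factorial : ℝ) / 2 *
            (mean θ i ⬝ᵥ (cov θ j * (cov θ i * cov θ j) ^ m).mulVec (mean θ i)) +
          ((2 * m + 2).factorial : ℝ) / 2 *
            (mean θ j ⬝ᵥ ((cov θ i * cov θ j) ^ m * cov θ i).mulVec (mean θ j))) ∧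
      DifferentiableAt ℝ (fun θ' : ParamIdx K d R → ℝ => alpha k θ') θ) ∧
    (∃ C : ℕ, ∀ (k K d Rmax : ℕ) (R : Fin K → ℕ),
      1 ≤ k → Rmax = Finset.univ.sup R → 1 ≤ Rmax → Rmax ≤ d →
      (∃ P : ArithProgram (ParamIdx K d R) Unit,
        P.cost ≤ C * (k ^ 2 * K ^ 2 + k * K ^ 2 * d * Rmax ^ 2) ∧
        ∀ θ : ParamIdx K d R → ℝ, IsMixtureParam θ → P.eval θ () = alpha k θ) ∧
      ∀ j : Fin K,
        (∃ P : ArithProgram (ParamIdx K d R) Unit,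
          P.cost ≤ C * (k ^ 2 * K + k * K * d * Rmax ^ 2) ∧
          ∀ θ : ParamIdx K d R → ℝ, IsMixtureParam θ →
            P.eval θ () = partialAlpha k θ (weightIdx j)) ∧
        (∃ P : ArithProgram (ParamIdx K d R) (Fin d),
          P.cost ≤ C * (k ^ 2 * K ^ 2 + k * K ^ 2 * d * Rmax ^ 2) ∧
          ∀ θ : ParamIdx K d R → ℝ, IsMixtureParam θ →
            ∀ a, P.eval θ a = partialAlpha k θ (meanIdx j a)) ∧
        (∃ P : ArithProgram (ParamIdx K d R) (Fin d × Fin (R j)),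
          P.cost ≤ C * (k ^ 2 * K ^ 2 + k * K ^ 2 * d * Rmax ^ 2) ∧
          ∀ θ : ParamIdx K d R → ℝ, IsMixtureParam θ →
            ∀ a r, P.eval θ (a, r) = partialAlpha k θ (factorIdx j a r))) := by
  refine ⟨fun k K d R θ hθ => ⟨integrable_prod_mixtureLaw θ,
    zero_mem_interior_integrableExpSet_pairing θ, alpha_eq_sum_inner hθ.1 k, ?_,
    fun i j m => ⟨kappa_odd θ i j m, kappa_even θ i j m⟩, differentiableAt_alpha hθ.1 k⟩, ?_⟩
  · rw [alpha_eq_alphaOf hθ.1]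
    simp only [completeBell_kappa]
    rfl
  -- `216 = 5 * 43 + 1`: the gradients by reverse-mode differentiation cost the most, and the one
  -- additional operation produces the constant zero.
  refine ⟨216, fun k K d ρ R hk hρR hρ hρd => ?_⟩
  have hR : ∀ j, R j ≤ ρ := fun j => hρR ▸ Finset.le_sup (Finset.mem_univ j)
  have hK : 1 ≤ K := by
    rcases Nat.eq_zero_or_pos K with rfl | h
    · simp at hρR
      omega
    · exact h
  have hpos : 1 ≤ k ^ 2 * K ^ 2 := Nat.mul_pos (Nat.pow_pos hk) (Nat.pow_pos hK)
  have hpos' : 1 ≤ k ^ 2 * K := Nat.mul_pos (Nat.pow_pos hk) hK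
  set S : Set (MvPolynomial (ParamIdx K d R) ℝ) :=
    insert 0 (insert 1 (Set.range MvPolynomial.X)) with hS
  have h0 : 0 ∈ S := by simp [hS]
  have h1 : 1 ∈ S := by simp [hS]
  have hX : ∀ p, MvPolynomial.X p ∈ S := fun p => by simp [hS]
  have hα := computes_alphaOf hk hR hρ hρd h0 h1 hX
  refine ⟨?_, fun j => ⟨?_, ?_, ?_⟩⟩
  · obtain ⟨P, hP, hP'⟩ := ArithProgram.exists_of_computes_insert_zero
      (f := fun _ : Unit => alphaOf MvPolynomial.X k) (by simpa using hα)
    exact ⟨P, by omega, fun θ hθ => by rw [hP', eval_alphaOf_X, alpha_eq_alphaOf hθ.1]⟩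
  · obtain ⟨P, hP, hP'⟩ := ArithProgram.exists_of_computes_insert_zero
      (f := fun _ : Unit => MvPolynomial.pderiv (weightIdx j) (alphaOf MvPolynomial.X k)) (by
        rw [Set.range_const, pderiv_weightIdx_alphaOf]
        exact computes_weight_gradient hk hR hρ hρd h0 h1 hX j)
    exact ⟨P, by omega, fun θ hθ => by rw [hP', partialAlpha_eq hθ.1]⟩
  · obtain ⟨P, hP, hP'⟩ := ArithProgram.exists_of_computes_insert_zero
      (hα.range_pderiv fun a : Fin d => meanIdx j a)
    exact ⟨P, by omega, fun θ hθ a => by rw [hP', partialAlpha_eq hθ.1]⟩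
  · obtain ⟨P, hP, hP'⟩ := ArithProgram.exists_of_computes_insert_zero
      (hα.range_pderiv fun q : Fin d × Fin (R j) => factorIdx j q.1 q.2)
    exact ⟨P, by omega, fun θ hθ a r => by rw [hP', partialAlpha_eq hθ.1]⟩
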